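/- Let $(X,d)$ be a compact metric space with its Borel $\sigma$-algebra, and let $\rho$ be a Borel probability measure on $X\times\mathbb R$ with marginal $\rho_X$ on $X$, conditional measures $\rho(\cdot|x)$, and regression function $f_\rho(x)=\int y\,d\rho(y|x)$. Put $\mathcal E(f)=\int |f(x)-y|^2\,d\rho(x,y)$. Suppose that: (1) the output is bounded: there is $M>0$ with $|y|\le M$ for $\rho$-almost every $(x,y)$; (2) there are $\eta,C_\eta>0$ such that the least number $\mathcal N(X,r)$ of open balls of radius $r$ that cover $X$ satisfies $\mathcal N(X,r)\le C_\eta r^{-\eta}$ for all $0<r\le 1$; (3) $K:X\times X\to\mathbb R$ is a positive-definite reproducing kernel, i.e. $K$ is symmetric and $\sum_{i,j}c_ic_jK(x_i,x_j)\ge 0$ for all finitely many points $x_i\in X$ and $c_i\in\mathbb R$; moreover there are $\alpha,C_\alpha>0$ with $|K(x,t)-K(x,t')|\le C_\alpha\, d(t,t')^\alpha$ for all $x,t,t'\in X$; and the linear span of $\{K(\cdot,x):x\in X\}$ is dense in $C(X)$ for the maximum norm; (4) (condition (H2)) for all $n$ and all pairwise distinct $x_1,\dots,x_n\in X$ the matrix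 $K[\mathbf x]=(K(x_k,x_j))_{j,k}$ is nonsingular and $\|K[\mathbf x]^{-1}K_{\mathbf x}(t)\|_1\le 1$ for all $t\in X$, where $K_{\mathbf x}(t)=(K(t,x_j))_{j}\in\mathbb R^n$ and $\|\cdot\|_1$ is the $\ell^1$ norm; (5) $f_\rho\in\operatorname{ran}(L_K^s)$ for some $s>0$, where $L_Kf=\int_X K(t,\cdot)f(t)\,d\rho_X(t)$ is the (compact, positive, self-adjoint) integral operator on $L^2_{\rho_X}$. For $m\ge 1$, a sample $\mathbf z=((x_1,y_1),\dots,(x_m,y_m))$ and $\lambda>0$, let $\mathbf c_{\mathbf z,\lambda}$ be a minimizer over $\mathbf c\in\mathbb R^m$ of $$\frac1m\sum_{j=1}^m\Bigl|\sum_{k=1}^m c_kK(x_k,x_j)-y_j\Bigr|^2+\lambda\|\mathbf c\|_1,$$ and let $f_{\mathbf z,\lambda}=\sum_{j=1}^m(\mathbf c_{\mathbf z,\lambda})_jK(x_j,\cdot)$. Then there is a constant $C>0$ (independent of $m$, $\delta$ and $\mathbf z$) such that for every $m\ge1$, with the choice $$\lambda=m^{-\frac12\,\frac1{1+\eta/\alpha}\,\frac{1+s}{1+2s}},$$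 and for every $0<\delta<1$, the following holds with probability at least $1-\delta$ over samples $\mathbf z$ of $m$ independent draws from $\rho$, simultaneously for all minimizers $\mathbf c_{\mathbf z,\lambda}$: $$\mathcal E(f_{\mathbf z,\lambda})-\mathcal E(f_\rho)\le C\,m^{-\frac{s}{1+2s}\,\frac1{1+\eta/\alpha}}\,\log\frac{2+2m}{\delta}\qquad\text{if }0<s<1,$$ $$\mathcal E(f_{\mathbf z,\lambda})-\mathcal E(f_\rho)\le C\,m^{-\frac1{3(1+\eta/\alpha)}}\,\log\frac{1+m}{\delta}\qquad\text{if }s\ge1.$$ -/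

import Mathlib

open MeasureTheory ProbabilityTheory

namespace L1Learning

noncomputable section

/-! ## Kernels -/

section Kernel

variable {X : Type*}

/-- The kernel matrix `K[x]`, with entries `K[x]_{j,k} = K(x_k, x_j)`. -/
def kernelMatrix (K : X → X → ℝ) {n : ℕ} (x : Fin n → X) : Matrix (Fin n) (Fin n) ℝ :=
  Matrix.of fun j k => K (x k) (x j)

/-- The vector `K_x(t) = (K(t, x_j))_j`. -/
def kernelVector (K : X → X → ℝ) {n : ℕ} (x : Fin n → X) (t : X) : Fin n → ℝ :=
  fun j => K t (x j)

/-- Positive semidefinite kernels: `K` is symmetric and all finite quadratic forms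
`∑ c_i c_j K(x_i, x_j)` are nonnegative. -/
def IsPosDefKernel (K : X → X → ℝ) : Prop :=
  (Matrix.of K).PosSemidef

/-- Condition (H2): for pairwise distinct points `x_1, …, x_n`,
`‖K[x]⁻¹ K_x(t)‖₁ ≤ 1` for every `t`. The kernel matrix is required to be invertible,
so that the inverse is the genuine one. -/
def ConditionH2 (K : X → X → ℝ) : Prop :=
  ∀ (n : ℕ) (x : Fin n → X), Function.Injective x →
    IsUnit (kernelMatrix K x).det ∧
      ∀ t : X, ∑ j, |((kernelMatrix K x)⁻¹.mulVec (kernelVector K x t)) j| ≤ 1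

/-- The section `K(·, x)` as a continuous function. -/
def sectionMap [TopologicalSpace X] (K : C(X × X, ℝ)) (x : X) : C(X, ℝ) :=
  ⟨fun t => K (t, x), by fun_prop⟩

theorem continuous_sectionMap [TopologicalSpace X] (K : C(X × X, ℝ)) :
    Continuous (sectionMap K) :=
  ContinuousMap.continuous_of_continuous_uncurry _
    (by
      change Continuous fun p : X × X => K (p.2, p.1)
      fun_prop)

/-- The linear span of the functions `K(·, x)`, `x ∈ X`, is dense in `C(X)` (sup norm). -/
def SectionsDense [TopologicalSpace X] [CompactSpace X] (K : C(X × X, ℝ)) : Prop :=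
  (Submodule.span ℝ (Set.range (sectionMap K))).topologicalClosure = ⊤

/-- The least number of open balls of radius `r` that cover `X`. -/
def coveringNumber (X : Type*) [PseudoMetricSpace X] (r : ℝ) : ℕ :=
  sInf {n : ℕ | ∃ S : Finset X, S.card = n ∧ (⋃ c ∈ S, Metric.ball c r) = Set.univ}

end Kernel

/-! ## The integral operator and the range of its powers -/

section Operator

variable {X : Type*} [TopologicalSpace X] [CompactSpace X] [MeasurableSpace X] [BorelSpace X]

variable [SecondCountableTopologyEither X ℝ] (ν : Measure X) [IsFiniteMeasure ν]

theorem integral_section_eq_inner (K : C(X × X, ℝ)) (f : Lp ℝ 2 ν) (x : X) :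
    ∫ t, K (t, x) * f t ∂ν
      = inner ℝ (ContinuousMap.toLp 2 ν ℝ (sectionMap K x)) f := by
  rw [L2.inner_def]
  refine integral_congr_ae ?_
  filter_upwards [ContinuousMap.coeFn_toLp (p := 2) (𝕜 := ℝ) ν (sectionMap K x)] with t ht
  rw [ht]
  simp [sectionMap, mul_comm]

/-- The continuous function `x ↦ ∫ K(t, x) f(t) dν(t)`, for `f ∈ L²(ν)`. -/
def integralTransform (K : C(X × X, ℝ)) (f : Lp ℝ 2 ν) : C(X, ℝ) where
  toFun x := ∫ t, K (t, x) * f t ∂ν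
  continuous_toFun := by
    simp_rw [integral_section_eq_inner]
    exact ((ContinuousMap.toLp 2 ν ℝ).continuous.comp (continuous_sectionMap K)).inner
      continuous_const

theorem norm_integralTransform_le (K : C(X × X, ℝ)) (f : Lp ℝ 2 ν) :
    ‖integralTransform ν K f‖
      ≤ ‖(ContinuousMap.toLp 2 ν ℝ : C(X, ℝ) →L[ℝ] Lp ℝ 2 ν)‖ * ‖K‖ * ‖f‖ := by
  refine (ContinuousMap.norm_le _ (by positivity)).2 fun x => ?_
  change ‖∫ t, K (t, x) * f t ∂ν‖ ≤ _
  rw [integral_section_eq_inner]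
  refine (norm_inner_le_norm _ _).trans ?_
  gcongr
  refine (ContinuousLinearMap.le_opNorm _ _).trans ?_
  gcongr
  exact (ContinuousMap.norm_le _ (norm_nonneg _)).2 fun t => K.norm_coe_le_norm (t, x)

/-- The map `f ↦ ∫ K(t, ·) f(t) dν(t)` from `L²(ν)` to `C(X)`, as a linear map. -/
def integralLinearMap (K : C(X × X, ℝ)) : Lp ℝ 2 ν →ₗ[ℝ] C(X, ℝ) where
  toFun := integralTransform ν K
  map_add' f g := by
    ext x
    change ∫ t, K (t, x) * (f + g : Lp ℝ 2 ν) t ∂ν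
      = (∫ t, K (t, x) * f t ∂ν) + ∫ t, K (t, x) * g t ∂ν
    simp_rw [integral_section_eq_inner, inner_add_right]
  map_smul' c f := by
    ext x
    change ∫ t, K (t, x) * (c • f : Lp ℝ 2 ν) t ∂ν = c * ∫ t, K (t, x) * f t ∂ν
    simp_rw [integral_section_eq_inner, inner_smul_right]

/-- The integral operator `L_K f = ∫ K(t, ·) f(t) dν(t)` as a bounded operator on `L²(ν)`. -/
def integralOperator (K : C(X × X, ℝ)) : Lp ℝ 2 ν →L[ℝ] Lp ℝ 2 ν :=
  (ContinuousMap.toLp 2 ν ℝ : C(X, ℝ) →L[ℝ] Lp ℝ 2 ν).comp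
    ((integralLinearMap ν K).mkContinuous _ (norm_integralTransform_le ν K))

theorem integralOperator_ae_eq (K : C(X × X, ℝ)) (f : Lp ℝ 2 ν) :
    integralOperator ν K f =ᵐ[ν] fun x => ∫ t, K (t, x) * f t ∂ν :=
  ContinuousMap.coeFn_toLp (p := 2) (𝕜 := ℝ) ν (integralTransform ν K f)

end Operator

/-- The orthogonal projection onto the eigenspace `{v | T v = μ v}`. -/
def eigenProjection {H : Type*} [NormedAddCommGroup H] [InnerProductSpace ℝ H] [CompleteSpace H]
    (T : H →L[ℝ] H) (μ : ℝ) : H →L[ℝ] H :=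
  (LinearMap.ker (T - μ • ContinuousLinearMap.id ℝ H).toLinearMap).starProjection

/-- The range of the power `T ^ s` (`s > 0`) of a compact positive self-adjoint operator `T`:
the vectors `T ^ s h = ∑_μ μ ^ s P_μ h`, `h ∈ H`, where the sum is over the eigenvalues `μ` of `T`
and `P_μ` is the orthogonal projection onto the eigenspace of `μ` (it vanishes if `μ` is not an
eigenvalue). In an orthonormal basis `φ_j` of eigenvectors with eigenvalues `λ_j` this is
`T ^ s (∑ a_j φ_j) = ∑ λ_j ^ s a_j φ_j`. -/
def rangeOfPower {H : Type*} [NormedAddCommGroup H] [InnerProductSpace ℝ H] [CompleteSpace H]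
    (T : H →L[ℝ] H) (s : ℝ) : Set H :=
  {g | ∃ h : H, HasSum (fun μ : ℝ => μ ^ s • eigenProjection T μ h) g}

/-! ## Least square regression -/

section Regression

variable {X : Type*}

/-- The regression function `f_ρ(x) = ∫ y dρ(y|x)`. -/
def regressionFunction [MeasurableSpace X] (ρ : Measure (X × ℝ)) [IsFiniteMeasure ρ] (x : X) : ℝ :=
  ∫ y, y ∂(ρ.condKernel x)

/-- The error `𝓔(f) = ∫ |f(x) - y|² dρ`. -/
def generalizationError [MeasurableSpace X] (ρ : Measure (X × ℝ)) (f : X → ℝ) : ℝ :=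
  ∫ z, (f z.1 - z.2) ^ 2 ∂ρ

/-- The function `K^x(·) c = ∑_j c_j K(x_j, ·)` for a sample `z = (x_j, y_j)_j`. -/
def kernelExpansion (K : X → X → ℝ) {m : ℕ} (z : Fin m → X × ℝ) (c : Fin m → ℝ) (x : X) : ℝ :=
  ∑ j, c j * K (z j).1 x

/-- The objective `(1/m) ∑_j |K^x(x_j) c - y_j|² + λ ‖c‖₁`. -/
def l1Objective (K : X → X → ℝ) {m : ℕ} (z : Fin m → X × ℝ) (lam : ℝ) (c : Fin m → ℝ) : ℝ :=
  (1 / (m : ℝ)) * ∑ j, (kernelExpansion K z c (z j).1 - (z j).2) ^ 2 + lam * ∑ j, |c j|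

/-- `c` is a minimizer of the `ℓ¹`-regularized least square regression. -/
def IsL1Minimizer (K : X → X → ℝ) {m : ℕ} (z : Fin m → X × ℝ) (lam : ℝ) (c : Fin m → ℝ) : Prop :=
  ∀ c' : Fin m → ℝ, l1Objective K z lam c ≤ l1Objective K z lam c'

/-- `P` holds with confidence `1 - δ`: it holds on an event of probability at least `1 - δ`. -/
def HoldsWithConfidence {Ω : Type*} [MeasurableSpace Ω] (μ : Measure Ω) (δ : ℝ) (P : Ω → Prop) :
    Prop :=
  ∃ E : Set Ω, MeasurableSet E ∧ ENNReal.ofReal (1 - δ) ≤ μ E ∧ ∀ ω ∈ E, P ω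

end Regression

end

end L1Learning

open L1Learning

/-! Write T for the integral operator, g for the L² class of the regression function, and θ =
1/(1+η/α).

Statistical error. The mean excess loss of a bounded f is ‖f − g‖², and the second moment of the
excess loss is at most a constant times this mean. A Bernstein bound therefore gives deviations of
order 1/m rather than 1/√m. Comparison with c = 0 puts every minimizer in the ℓ¹ ball of radius
M²/λ. Moving nodes to a net of X of radius m^(−θ/α) and rounding coefficients replaces the ball by a
finite family whose log-cardinality is m^(1−θ) up to logarithms. The uniform error is then Δ of
order m^(−θ) log((2+2m)/δ)/λ² (`exists_uniform_event`).

Comparison function. (H2) says that each section of K is interpolated at any nodes with weights of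
ℓ¹ norm at most 1. Integrating this against p, the function Tp agrees on the sample with an
expansion of ℓ¹ norm at most ∫|p| (`exists_interpolation`). Hence the excess error is at most 4‖Tp −
g‖² + 2λ(∫|p| − ‖c‖₁) + 3Δ (`integral_excessLoss_minimizer_le`).

For s < 1 take p = (T+ε)⁻¹g, drop ‖c‖₁ and balance ε. For s ≥ 1 write g = Tg₀ and take p = g₀, so
that the approximation error vanishes. Dropping ‖c‖₁ would leave a term of order λ, too large when s
> 1. Instead ‖c‖₁ is bounded below by duality: if |Tq| ≤ 1 everywhere, then ⟨q, f⟩ ≤ ‖c‖₁ for the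
expansion f. With q = (T+ε)⁻¹ sign(g₀) the constraint |Tq| ≤ 1 is a maximum principle for the
resolvent (`abs_integralTransform_le_one`), the continuous counterpart of (H2). It gives ∫|g₀| −
‖c‖₁ ≤ ε‖(T+ε)⁻¹g₀‖ + ε⁻¹‖f − g‖, whose last term is absorbed into ‖f − g‖². -/

namespace L1Learning

noncomputable section

/-! ### Finite kernel expansions under (H2) -/

section FiniteKernel

variable {X : Type*} {K : X → X → ℝ}

theorem IsPosDefKernel.symm (hpos : IsPosDefKernel K) (x t : X) : K x t = K t x := by
  have h := hpos.1
  have := congrFun (congrFun h t) x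
  simpa [Matrix.conjTranspose] using this

theorem IsPosDefKernel.quadratic_nonneg (hpos : IsPosDefKernel K) (S : Finset X) (a : X → ℝ) :
    0 ≤ ∑ p ∈ S, ∑ q ∈ S, a p * K p q * a q := by
  classical
  have h := hpos.2 (Finsupp.indicator S fun p _ => a p)
  have hs : (Finsupp.indicator S fun p _ => a p).support ⊆ S := Finsupp.support_indicator_subset _ _
  rw [Finsupp.sum_of_support_subset _ hs _ (by simp [Finsupp.sum])] at h
  refine h.trans_eq (Finset.sum_congr rfl fun p hp => ?_)
  rw [Finsupp.sum_of_support_subset _ hs _ (by simp)]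
  refine Finset.sum_congr rfl fun q hq => ?_
  simp [Finsupp.indicator_apply, hp, hq]

/-- The inverse of the kernel matrix of a finite set of points. -/
theorem ConditionH2.exists_inverse (hH2 : ConditionH2 K) (hpos : IsPosDefKernel K)
    (S : Finset X) :
    ∃ B : X → X → ℝ, (∀ p q, B p q = B q p) ∧
      (∀ t, ∑ p ∈ S, |∑ q ∈ S, B p q * K t q| ≤ 1) ∧
      (∀ b : X → ℝ, ∀ r ∈ S, ∑ p ∈ S, (∑ q ∈ S, B p q * b q) * K p r = b r) ∧
      (∀ a : X → ℝ, ∀ r ∈ S, ∑ q ∈ S, B r q * (∑ p ∈ S, a p * K p q) = a r) := by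
  classical
  let e := S.equivFin
  let x : Fin S.card → X := fun i => (e.symm i : X)
  have hx : Function.Injective x := Subtype.val_injective.comp e.symm.injective
  obtain ⟨hdet, hle⟩ := hH2 _ x hx
  set A := kernelMatrix K x with hA
  let B : X → X → ℝ := fun p q =>
    if hp : p ∈ S then if hq : q ∈ S then A⁻¹ (e ⟨p, hp⟩) (e ⟨q, hq⟩) else 0 else 0
  have hsum : ∀ f : X → ℝ, ∑ p ∈ S, f p = ∑ i, f (x i) := by
    intro f
    rw [← Finset.sum_coe_sort]
    exact (Equiv.sum_comp e.symm fun p : S => f p).symm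
  have hB : ∀ i j, B (x i) (x j) = A⁻¹ i j := by
    intro i j
    have hi : ∀ i, x i ∈ S := fun i => (e.symm i).2
    have : ∀ i, e ⟨x i, hi i⟩ = i := fun i => e.apply_symm_apply i
    simp only [B, hi, dite_true, this]
  have hAsymm : A.transpose = A := by
    ext i j
    simp only [hA, kernelMatrix, Matrix.transpose_apply, Matrix.of_apply]
    exact hpos.symm _ _
  have hx' : ∀ r ∈ S, ∃ i, x i = r := fun r hr => ⟨e ⟨r, hr⟩, by simp [x]⟩
  have hAinv : ∀ i j, A⁻¹ i j = A⁻¹ j i := by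
    intro i j
    have : A⁻¹.transpose = A⁻¹ := by rw [Matrix.transpose_nonsing_inv, hAsymm]
    exact (congrFun (congrFun this i) j).symm
  refine ⟨B, ?_, ?_, ?_, ?_⟩
  · intro p q
    simp only [B]
    split_ifs
    · exact hAinv _ _
    · rfl
    · rfl
    · rfl
  · intro t
    simp only [hsum, hB]
    exact hle t
  · intro b r hr
    obtain ⟨i, rfl⟩ := hx' r hr
    simp only [hsum, hB]
    have h1 : A.mulVec (A⁻¹.mulVec fun j => b (x j)) = fun j => b (x j) := by
      rw [Matrix.mulVec_mulVec, Matrix.mul_nonsing_inv _ hdet, Matrix.one_mulVec]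
    have := congrFun h1 i
    rw [← this]
    simp only [Matrix.mulVec, dotProduct, hA, kernelMatrix, Matrix.of_apply]
    exact Finset.sum_congr rfl fun j _ => mul_comm _ _
  · intro a r hr
    obtain ⟨i, rfl⟩ := hx' r hr
    simp only [hsum, hB]
    have h1 : A⁻¹.mulVec (A.mulVec fun j => a (x j)) = fun j => a (x j) := by
      rw [Matrix.mulVec_mulVec, Matrix.nonsing_inv_mul _ hdet, Matrix.one_mulVec]
    have := congrFun h1 i
    rw [← this]
    simp only [Matrix.mulVec, dotProduct, hA, kernelMatrix, Matrix.of_apply]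
    exact Finset.sum_congr rfl fun j _ => by
      congr 1; exact Finset.sum_congr rfl fun j _ => mul_comm _ _

/-- A kernel expansion is bounded by its values at the nodes. -/
theorem ConditionH2.abs_expansion_le (hH2 : ConditionH2 K) (hpos : IsPosDefKernel K)
    (S : Finset X) (a : X → ℝ) {N : ℝ} (hN : 0 ≤ N)
    (h : ∀ q ∈ S, |∑ p ∈ S, a p * K p q| ≤ N) (t : X) : |∑ p ∈ S, a p * K p t| ≤ N := by
  obtain ⟨B, hBs, hB1, -, hB3⟩ := hH2.exists_inverse hpos S
  set F : X → ℝ := fun q => ∑ p ∈ S, a p * K p q with hF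
  -- Lagrange form: the value at t is a combination of the values at the nodes, with weights
  -- K[x]⁻¹K_x(t), whose ℓ¹ norm is at most 1 by (H2).
  have key : ∑ p ∈ S, a p * K p t = ∑ q ∈ S, F q * ∑ p ∈ S, B q p * K t p := by
    calc ∑ p ∈ S, a p * K p t
        = ∑ p ∈ S, (∑ q ∈ S, B p q * F q) * K t p :=
          Finset.sum_congr rfl fun p hp => by rw [hB3 a p hp, hpos.symm]
      _ = ∑ q ∈ S, F q * ∑ p ∈ S, B q p * K t p := by
          simp_rw [Finset.sum_mul, Finset.mul_sum]
          rw [Finset.sum_comm]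
          refine Finset.sum_congr rfl fun q _ => Finset.sum_congr rfl fun p _ => ?_
          rw [hBs p q]; ring
  rw [key]
  calc |∑ q ∈ S, F q * ∑ p ∈ S, B q p * K t p|
      ≤ ∑ q ∈ S, |F q * ∑ p ∈ S, B q p * K t p| := Finset.abs_sum_le_sum_abs _ _
    _ ≤ ∑ q ∈ S, N * |∑ p ∈ S, B q p * K t p| := by
        refine Finset.sum_le_sum fun q hq => ?_
        rw [abs_mul]
        exact mul_le_mul_of_nonneg_right (h q hq) (abs_nonneg _)
    _ = N * ∑ q ∈ S, |∑ p ∈ S, B q p * K t p| := by rw [Finset.mul_sum]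
    _ ≤ N * 1 := mul_le_mul_of_nonneg_left (hB1 t) hN
    _ = N := mul_one N

/-- Maximum principle: at a node where a kernel expansion is largest in absolute value, the
coefficient does not have the opposite sign. -/
theorem ConditionH2.coeff_mul_nonneg (hH2 : ConditionH2 K) (hpos : IsPosDefKernel K)
    (S : Finset X) (a : X → ℝ) {i : X} (hi : i ∈ S)
    (h : ∀ q ∈ S, |∑ p ∈ S, a p * K p q| ≤ |∑ p ∈ S, a p * K p i|) :
    0 ≤ a i * ∑ p ∈ S, a p * K p i := by
  classical
  set F : X → ℝ := fun q => ∑ p ∈ S, a p * K p q with hF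
  -- Let G interpolate F at all nodes except i. Its nodal values are at most |F i|, so the previous
  -- bound gives |G i| ≤ |F i|, and F i − G i cannot have the sign opposite to F i.
  obtain ⟨B', -, -, hB2', -⟩ := hH2.exists_inverse hpos (S.erase i)
  set b : X → ℝ := fun p => if p = i then 0 else ∑ q ∈ S.erase i, B' p q * F q with hb
  have hbsum : ∀ q, ∑ p ∈ S, b p * K p q
      = ∑ p ∈ S.erase i, (∑ q ∈ S.erase i, B' p q * F q) * K p q := by
    intro q
    rw [← Finset.sum_erase_add _ _ hi]
    simp only [hb, if_true, zero_mul, add_zero]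
    exact Finset.sum_congr rfl fun p hp => by rw [if_neg (Finset.ne_of_mem_erase hp)]
  have hG : ∀ q ∈ S.erase i, ∑ p ∈ S, b p * K p q = F q := fun q hq => by
    rw [hbsum, hB2' F q hq]
  have hGi : |∑ p ∈ S, b p * K p i| ≤ |F i| := by
    rw [hbsum]
    refine hH2.abs_expansion_le hpos (S.erase i) _ (abs_nonneg _) (fun q hq => ?_) i
    rw [hB2' F q hq]
    exact h q (Finset.mem_of_mem_erase hq)
  set G := ∑ p ∈ S, b p * K p i with hGdef
  have hdiff : ∀ q ∈ S, ∑ p ∈ S, (a p - b p) * K p q = if q = i then F i - G else 0 := by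
    intro q hq
    simp_rw [sub_mul, Finset.sum_sub_distrib]
    split_ifs with hqi
    · rw [hqi]
    · rw [hG q (Finset.mem_erase.2 ⟨hqi, hq⟩)]
      exact sub_self _
  have hbi : b i = 0 := by simp [hb]
  -- F − G vanishes at every node but i, so its quadratic form reduces to one term; the coefficient
  -- there is a i because b i = 0.
  have hquad : 0 ≤ a i * (F i - G) := by
    have := hpos.quadratic_nonneg S fun p => a p - b p
    rw [Finset.sum_comm] at this
    simp_rw [← Finset.sum_mul] at this
    rw [Finset.sum_congr rfl fun q hq => by rw [hdiff q hq]] at this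
    simp only [ite_mul, zero_mul, Finset.sum_ite_eq', hi, if_true, hbi, sub_zero] at this
    linarith
  change 0 ≤ a i * F i
  -- In this case F − G vanishes at all nodes, and invertibility of the kernel matrix forces a i = b
  -- i = 0.
  by_cases hFG : F i - G = 0
  · obtain ⟨B, -, -, -, hB3⟩ := hH2.exists_inverse hpos S
    have h0 := hB3 (fun p => a p - b p) i hi
    rw [Finset.sum_congr rfl fun q hq => by rw [hdiff q hq]] at h0
    simp only [hFG, ite_self, mul_zero, Finset.sum_const_zero, hbi, sub_zero] at h0
    rw [← h0, zero_mul]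
  · rcases le_total 0 (F i) with hF0 | hF0
    · rw [abs_of_nonneg hF0] at hGi
      have h1 : 0 < F i - G := lt_of_le_of_ne (by linarith [le_abs_self G]) (Ne.symm hFG)
      exact mul_nonneg (nonneg_of_mul_nonneg_left hquad h1) hF0
    · rw [abs_of_nonpos hF0] at hGi
      have h1 : F i - G < 0 := lt_of_le_of_ne (by linarith [neg_abs_le G]) hFG
      have h2 : a i ≤ 0 := by
        by_contra hc
        push Not at hc
        exact absurd hquad (not_le.2 (mul_neg_of_pos_of_neg hc h1))
      exact mul_nonneg_of_nonpos_of_nonpos h2 hF0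

/-- An expansion over the set of the points of a family is an expansion over the family. -/
theorem exists_coeff_of_finset {m : ℕ} [DecidableEq X] (x : Fin m → X) (a : X → ℝ) :
    ∃ c : Fin m → ℝ, (∀ t, ∑ j, c j * K (x j) t = ∑ p ∈ Finset.univ.image x, a p * K p t) ∧
      ∑ j, |c j| = ∑ p ∈ Finset.univ.image x, |a p| := by
  rcases isEmpty_or_nonempty (Fin m) with hm | hm
  · exact ⟨fun _ => 0, by simp, by simp⟩
  have hex : ∀ p ∈ Finset.univ.image x, ∃ j, x j = p := fun p hp => by
    simpa using hp
  choose! r hr using hex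
  -- Sample points may repeat: one representative index carries the whole coefficient of a point,
  -- the others carry 0.
  let c : Fin m → ℝ := fun j => if r (x j) = j then a (x j) else 0
  have key : ∀ g : X → ℝ, ∑ j, (if r (x j) = j then g (x j) else 0)
      = ∑ p ∈ Finset.univ.image x, g p := by
    intro g
    rw [← Finset.sum_filter]
    refine Finset.sum_bij' (fun j _ => x j) (fun p _ => r p) ?_ ?_ ?_ ?_ ?_
    · intro j _; simp
    · intro p hp
      simp only [Finset.mem_filter, Finset.mem_univ, true_and]
      rw [hr p hp]
    · intro j hj
      exact (Finset.mem_filter.1 hj).2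
    · intro p hp; exact hr p hp
    · intro j _; rfl
  refine ⟨c, fun t => ?_, ?_⟩
  · rw [← key fun p => a p * K p t]
    refine Finset.sum_congr rfl fun j _ => ?_
    simp only [c]; split_ifs <;> simp
  · rw [← key fun p => |a p|]
    refine Finset.sum_congr rfl fun j _ => ?_
    simp only [c]; split_ifs <;> simp

end FiniteKernel

/-! ### Discretization of integrals by maps with finite range -/

section Discretization

variable {X : Type*} [MeasurableSpace X] {ν : Measure X}

theorem integral_comp_simpleFunc_mul (π : SimpleFunc X X) (g : X → ℝ) {q : X → ℝ}
    (hq : Integrable q ν) :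
    ∫ y, g (π y) * q y ∂ν = ∑ p ∈ π.range, (∫ y in π ⁻¹' {p}, q y ∂ν) * g p := by
  have hU : (⋃ p ∈ π.range, π ⁻¹' {p}) = Set.univ := by
    ext y; simp
  have hint : Integrable (fun y => g (π y) * q y) ν := by
    have hm : AEStronglyMeasurable (fun y => g (π y)) ν :=
      (π.map g).measurable.aestronglyMeasurable
    obtain ⟨C, hC⟩ := (π.map g).exists_forall_norm_le
    exact hq.bdd_mul hm (Filter.Eventually.of_forall hC)
  rw [← setIntegral_univ, ← hU, integral_biUnion_finset]
  · refine Finset.sum_congr rfl fun p _ => ?_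
    rw [setIntegral_congr_fun (g := fun y => g p * q y) (π.measurableSet_fiber p)
      (fun y hy => by
        have : π y = p := hy
        simp only [this]), integral_const_mul, mul_comm]
  · exact fun p _ => π.measurableSet_fiber p
  · intro p _ p' _ hpp'
    exact Set.disjoint_left.2 fun y hy hy' => hpp' (hy.symm.trans hy')
  · exact fun p _ => hint.integrableOn

theorem sum_abs_setIntegral_fiber_le (π : SimpleFunc X X) {q : X → ℝ} (hq : Integrable q ν) :
    ∑ p ∈ π.range, |∫ y in π ⁻¹' {p}, q y ∂ν| ≤ ∫ y, |q y| ∂ν := by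
  have h := integral_comp_simpleFunc_mul (ν := ν) π (fun _ => 1) hq.abs
  simp only [one_mul, mul_one] at h
  rw [h]
  exact Finset.sum_le_sum fun p _ => abs_integral_le_integral_abs

end Discretization

section NearestPoint

variable {X : Type*} [MetricSpace X] [CompactSpace X] [MeasurableSpace X] [BorelSpace X]

theorem exists_simpleFunc_dist_lt {r : ℝ} (hr : 0 < r) :
    ∃ π : SimpleFunc X X, ∀ y, dist (π y) y < r := by
  rcases isEmpty_or_nonempty X with hX | hX
  · exact ⟨SimpleFunc.ofIsEmpty, fun y => hX.elim y⟩
  obtain ⟨t, -, htf, ht⟩ := finite_cover_balls_of_compact (isCompact_univ (X := X)) hr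
  obtain ⟨e, he⟩ := htf.countable.exists_eq_range
    (by
      obtain ⟨y⟩ := hX
      have := ht (Set.mem_univ y)
      simp only [Set.mem_iUnion] at this
      obtain ⟨c, hc, -⟩ := this
      exact ⟨c, hc⟩)
  have hcov : ∀ y : X, ∃ k, edist (e k) y < ENNReal.ofReal r := by
    intro y
    have := ht (Set.mem_univ y)
    simp only [Set.mem_iUnion] at this
    obtain ⟨c, hc, hy⟩ := this
    rw [he] at hc
    obtain ⟨k, rfl⟩ := hc
    refine ⟨k, ?_⟩
    rw [edist_dist, dist_comm]
    exact (ENNReal.ofReal_lt_ofReal_iff hr).2 hy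
  -- `SimpleFunc.nearestPt e N` only uses e 0, …, e N, so N must exceed an index of each of the
  -- finitely many centres.
  have hN : ∃ N, ∀ c ∈ t, ∃ k ≤ N, e k = c := by
    have h1 : ∀ c ∈ t, ∃ k, e k = c := fun c hc => by rw [he] at hc; exact hc
    choose! k hk using h1
    obtain ⟨N, hN⟩ := (htf.image k).bddAbove
    exact ⟨N, fun c hc => ⟨k c, hN (Set.mem_image_of_mem _ hc), hk c hc⟩⟩
  obtain ⟨N, hN⟩ := hN
  refine ⟨SimpleFunc.nearestPt e N, fun y => ?_⟩
  have := ht (Set.mem_univ y)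
  simp only [Set.mem_iUnion] at this
  obtain ⟨c, hc, hy⟩ := this
  obtain ⟨k, hk, rfl⟩ := hN c hc
  have h1 := SimpleFunc.edist_nearestPt_le e y hk
  rw [edist_dist, edist_dist, ENNReal.ofReal_le_ofReal_iff dist_nonneg] at h1
  rw [Metric.mem_ball, dist_comm] at hy
  exact h1.trans_lt hy

end NearestPoint

section Prelim

variable {X : Type*}

theorem exists_dist_forall_abs_sub_le [MetricSpace X] [CompactSpace X] (K : C(X × X, ℝ)) {δ : ℝ} (hδ : 0 < δ) :
    ∃ r > 0, ∀ x y : X, dist x y < r →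
      ∀ t, |K (x, t) - K (y, t)| ≤ δ ∧ |K (t, x) - K (t, y)| ≤ δ := by
  have h := CompactSpace.uniformContinuous_of_continuous K.continuous
  obtain ⟨r, hr, hr'⟩ := Metric.uniformContinuous_iff.1 h δ hδ
  refine ⟨r, hr, fun x y hxy t => ⟨?_, ?_⟩⟩
  · have : dist (x, t) (y, t) < r := by simpa [Prod.dist_eq] using hxy.trans_le le_rfl
    exact (hr' this).le
  · have : dist (t, x) (t, y) < r := by simpa [Prod.dist_eq] using hxy.trans_le le_rfl
    exact (hr' this).le

theorem integrable_of_Lp [MeasurableSpace X] (ν : Measure X) [IsFiniteMeasure ν] (q : Lp ℝ 2 ν) : Integrable q ν :=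
  (Lp.memLp q).integrable one_le_two

theorem integral_abs_le_norm [MeasurableSpace X] {ν : Measure X} [IsProbabilityMeasure ν] (q : Lp ℝ 2 ν) :
    ∫ y, |q y| ∂ν ≤ ‖q‖ := by
  have h1 : eLpNorm q 1 ν ≤ eLpNorm q 2 ν :=
    eLpNorm_le_eLpNorm_of_exponent_le one_le_two (Lp.aestronglyMeasurable q)
  have h2 : ∫ y, |q y| ∂ν = (eLpNorm q 1 ν).toReal := by
    rw [eLpNorm_one_eq_lintegral_enorm, ← integral_norm_eq_lintegral_enorm
      (Lp.aestronglyMeasurable q)]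
    rfl
  rw [h2, Lp.norm_def]
  exact ENNReal.toReal_mono (Lp.eLpNorm_ne_top q) h1

theorem integrable_kernel_mul [MetricSpace X] [CompactSpace X] [MeasurableSpace X]
    [BorelSpace X] (ν : Measure X) (K : C(X × X, ℝ)) (q : X → ℝ) (hq : Integrable q ν) (t : X) :
    Integrable (fun y => K (y, t) * q y) ν :=
  hq.bdd_mul (c := ‖K‖) (by fun_prop)
    (Filter.Eventually.of_forall fun y => K.norm_coe_le_norm (y, t))

end Prelim

/-! ### The integral operator: symmetry, positivity, maximum principle -/

section Operator

variable {X : Type*} [MetricSpace X] [CompactSpace X] [MeasurableSpace X] [BorelSpace X]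
  (ν : Measure X) [IsFiniteMeasure ν] (K : C(X × X, ℝ))

theorem abs_integralTransform_le (q : Lp ℝ 2 ν) (x : X) :
    |integralTransform ν K q x| ≤ ‖K‖ * ∫ y, |q y| ∂ν := by
  change |∫ t, K (t, x) * q t ∂ν| ≤ _
  rw [← integral_const_mul]
  refine abs_integral_le_integral_abs.trans (integral_mono
    (integrable_kernel_mul ν K q (integrable_of_Lp ν q) x).abs
    ((integrable_of_Lp ν q).abs.const_mul _) fun y => ?_)
  simp only [abs_mul]
  exact mul_le_mul_of_nonneg_right (K.norm_coe_le_norm (y, x)) (abs_nonneg _)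

/-- On each fibre of π the section is frozen at the common value p, so the integral becomes an
expansion whose coefficients are the integrals of q over the fibres. This carries statements about
finite expansions over to the operator. -/
theorem abs_integralTransform_sub_sum_le (q : Lp ℝ 2 ν) (π : SimpleFunc X X) {δ : ℝ}
    (h : ∀ y t, |K (π y, t) - K (y, t)| ≤ δ) (x : X) :
    |integralTransform ν K q x - ∑ p ∈ π.range, (∫ y in π ⁻¹' {p}, q y ∂ν) * K (p, x)|
      ≤ δ * ∫ y, |q y| ∂ν := by
  have hq := integrable_of_Lp ν q
  rw [← integral_comp_simpleFunc_mul π (fun p => K (p, x)) hq]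
  change |∫ t, K (t, x) * q t ∂ν - _| ≤ _
  have hint : Integrable (fun y => K (π y, x) * q y) ν := by
    have hm : AEStronglyMeasurable (fun y => K (π y, x)) ν :=
      (π.map fun p => K (p, x)).measurable.aestronglyMeasurable
    exact hq.bdd_mul (c := ‖K‖) hm
      (Filter.Eventually.of_forall fun y => K.norm_coe_le_norm (π y, x))
  rw [← integral_sub (integrable_kernel_mul ν K q hq x) hint, ← integral_const_mul]
  refine abs_integral_le_integral_abs.trans (integral_mono
    ((integrable_kernel_mul ν K q hq x).sub hint).abs (hq.abs.const_mul _) fun y => ?_)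
  simp only [← sub_mul, abs_mul]
  exact mul_le_mul_of_nonneg_right (by rw [abs_sub_comm]; exact h y x) (abs_nonneg _)

theorem inner_integralOperator (f g : Lp ℝ 2 ν) :
    inner ℝ g (integralOperator ν K f) = ∫ x, integralTransform ν K f x * g x ∂ν := by
  rw [L2.inner_def]
  refine integral_congr_ae ?_
  filter_upwards [integralOperator_ae_eq ν K f] with x hx
  rw [hx]
  simp [integralTransform]

variable {K}

theorem integralOperator_symm (hpos : IsPosDefKernel fun x t => K (x, t)) (f g : Lp ℝ 2 ν) :
    inner ℝ (integralOperator ν K f) g = inner ℝ f (integralOperator ν K g) := by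
  rw [real_inner_comm, inner_integralOperator, inner_integralOperator]
  have hf := integrable_of_Lp ν f
  have hg := integrable_of_Lp ν g
  simp only [integralTransform, ContinuousMap.coe_mk]
  simp_rw [← integral_mul_const]
  rw [integral_integral_swap]
  · refine integral_congr_ae (Filter.Eventually.of_forall fun x => ?_)
    refine integral_congr_ae (Filter.Eventually.of_forall fun y => ?_)
    have := hpos.symm x y
    simp only at this ⊢
    rw [this]; ring
  · have : Integrable (fun z : X × X => g z.1 * f z.2) (ν.prod ν) := hg.mul_prod hf
    have h2 : Integrable (fun z : X × X => K (z.2, z.1) * (g z.1 * f z.2)) (ν.prod ν) :=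
      this.bdd_mul (c := ‖K‖) (by fun_prop)
        (Filter.Eventually.of_forall fun z => K.norm_coe_le_norm (z.2, z.1))
    refine h2.congr (Filter.Eventually.of_forall fun z => ?_)
    simp only [Function.uncurry]; ring

/-- Up to an error 2I²δ with I = ∫|q|, the form is a finite quadratic form of K in the fibre
integrals of q, which is nonnegative; then δ tends to 0. -/
theorem integralOperator_nonneg (hpos : IsPosDefKernel fun x t => K (x, t)) (q : Lp ℝ 2 ν) :
    0 ≤ inner ℝ q (integralOperator ν K q) := by
  rw [inner_integralOperator]
  have hq := integrable_of_Lp ν q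
  set I := ∫ y, |q y| ∂ν with hI
  have hI0 : 0 ≤ I := integral_nonneg fun y => abs_nonneg _
  suffices h : ∀ δ > 0, -(2 * I * I * δ) ≤ ∫ x, integralTransform ν K q x * q x ∂ν by
    by_contra hc
    push Not at hc
    set J := ∫ x, integralTransform ν K q x * q x ∂ν
    have hpos' : 0 < 2 * I * I + 1 := by positivity
    have := h (-J / (2 * I * I + 1)) (div_pos (by linarith) hpos')
    have h3 : 2 * I * I * (-J / (2 * I * I + 1)) < -J := by
      rw [← mul_div_assoc, div_lt_iff₀ hpos']
      nlinarith
    linarith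
  intro δ hδ
  obtain ⟨r, hr, hrK⟩ := exists_dist_forall_abs_sub_le K hδ
  obtain ⟨π, hπ⟩ := exists_simpleFunc_dist_lt (X := X) hr
  set a : X → ℝ := fun p => ∫ y in π ⁻¹' {p}, q y ∂ν with ha
  set F : X → ℝ := fun x => ∑ p ∈ π.range, a p * K (p, x) with hF
  have h1 : ∀ x, |integralTransform ν K q x - F x| ≤ δ * I :=
    abs_integralTransform_sub_sum_le ν K q π fun y t => (hrK _ _ (hπ y) t).1
  have hasum : ∑ p ∈ π.range, |a p| ≤ I := sum_abs_setIntegral_fiber_le π hq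
  have h2 : ∀ x, |F x - F (π x)| ≤ δ * I := by
    intro x
    simp only [hF, ← Finset.sum_sub_distrib, ← mul_sub]
    refine (Finset.abs_sum_le_sum_abs _ _).trans ?_
    calc ∑ p ∈ π.range, |a p * (K (p, x) - K (p, π x))|
        ≤ ∑ p ∈ π.range, |a p| * δ := by
          refine Finset.sum_le_sum fun p _ => ?_
          rw [abs_mul]
          refine mul_le_mul_of_nonneg_left ?_ (abs_nonneg _)
          rw [abs_sub_comm]
          exact (hrK _ _ (hπ x) p).2
      _ = δ * ∑ p ∈ π.range, |a p| := by rw [← Finset.sum_mul, mul_comm]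
      _ ≤ δ * I := mul_le_mul_of_nonneg_left hasum hδ.le
  have h3 : 0 ≤ ∫ x, F (π x) * q x ∂ν := by
    rw [integral_comp_simpleFunc_mul π F hq]
    have := hpos.quadratic_nonneg π.range a
    refine this.trans_eq ?_
    rw [Finset.sum_comm]
    refine Finset.sum_congr rfl fun p _ => ?_
    rw [hF, ← Finset.sum_mul, mul_comm]
  have hFint : Integrable (fun x => F (π x) * q x) ν := by
    have hm : AEStronglyMeasurable (fun y => F (π y)) ν :=
      (π.map F).measurable.aestronglyMeasurable
    obtain ⟨C, hC⟩ := (π.map F).exists_forall_norm_le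
    exact hq.bdd_mul hm (Filter.Eventually.of_forall hC)
  have hvint : Integrable (fun x => integralTransform ν K q x * q x) ν :=
    hq.bdd_mul (c := ‖integralTransform ν K q‖) (by fun_prop)
      (Filter.Eventually.of_forall fun y => ContinuousMap.norm_coe_le_norm _ y)
  have h4 : |∫ x, integralTransform ν K q x * q x ∂ν - ∫ x, F (π x) * q x ∂ν|
      ≤ 2 * I * I * δ := by
    rw [← integral_sub hvint hFint]
    have : 2 * I * I * δ = ∫ y, (2 * (δ * I)) * |q y| ∂ν := by
      rw [integral_const_mul, ← hI]; ring
    rw [this]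
    refine abs_integral_le_integral_abs.trans (integral_mono (hvint.sub hFint).abs
      (hq.abs.const_mul _) fun y => ?_)
    simp only [← sub_mul, abs_mul]
    refine mul_le_mul_of_nonneg_right ?_ (abs_nonneg _)
    have e1 := h1 y
    have e2 := h2 y
    rw [abs_le] at *
    constructor <;> linarith
  have := (abs_le.1 h4).1
  linarith

/-- Maximum principle for the resolvent of the integral operator. -/
theorem abs_integralTransform_le_one (hpos : IsPosDefKernel fun x t => K (x, t))
    (hH2 : ConditionH2 fun x t => K (x, t)) (q : Lp ℝ 2 ν) {v₀ : X → ℝ}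
    (hv₀ : ∀ᵐ y ∂ν, |v₀ y| ≤ 1) {ε : ℝ} (hε : 0 < ε)
    (h : ∀ᵐ y ∂ν, ε * q y + integralTransform ν K q y = v₀ y) (x : X) :
    |integralTransform ν K q x| ≤ 1 := by
  classical
  set v := integralTransform ν K q with hv
  have hq := integrable_of_Lp ν q
  by_contra hx
  push Not at hx
  obtain ⟨x₀, -, hx₀⟩ := (isCompact_univ (X := X)).exists_isMaxOn ⟨x, Set.mem_univ x⟩
    (f := fun y => |v y|) (by fun_prop)
  set N := |v x₀| with hN
  have hN1 : 1 < N := hx.trans_le (hx₀ (Set.mem_univ x))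
  -- Three errors of size γ are lost between the maximum N and the values of v on a fibre, and N −
  -- 3γ is still greater than 1.
  set γ := (N - 1) / 4 with hγ
  have hγ0 : 0 < γ := by rw [hγ]; linarith
  set I := ∫ y, |q y| ∂ν with hI
  have hI0 : 0 ≤ I := integral_nonneg fun y => abs_nonneg _
  have hδ : 0 < γ / (I + 1) := by positivity
  obtain ⟨r, hr, hrK⟩ := exists_dist_forall_abs_sub_le K hδ
  obtain ⟨r', hr', hrv⟩ := Metric.uniformContinuous_iff.1
    (CompactSpace.uniformContinuous_of_continuous v.continuous) γ hγ0
  obtain ⟨π, hπ⟩ := exists_simpleFunc_dist_lt (X := X) (lt_min hr hr')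
  set a : X → ℝ := fun p => ∫ y in π ⁻¹' {p}, q y ∂ν with ha
  -- Zero coefficients are discarded so that the sign of the coefficient at the maximizing node is
  -- strict; this is what produces the contradiction.
  set S := π.range.filter fun p => a p ≠ 0 with hS
  set F : X → ℝ := fun x => ∑ p ∈ S, a p * K (p, x) with hF
  have h1 : ∀ x, |v x - F x| ≤ γ := by
    intro x
    have := abs_integralTransform_sub_sum_le ν K q π
      (fun y t => (hrK _ _ ((hπ y).trans_le (min_le_left _ _)) t).1) x
    have hFs : F x = ∑ p ∈ π.range, a p * K (p, x) := by
      simp only [hF, hS]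
      refine Finset.sum_filter_of_ne fun p _ hp => ?_
      exact left_ne_zero_of_mul hp
    rw [hFs]
    refine this.trans ?_
    rw [div_mul_eq_mul_div, div_le_iff₀ (by positivity)]
    nlinarith
  have hFx₀ : N - γ ≤ |F x₀| := by
    have e1 := h1 x₀
    have e2 := abs_sub_abs_le_abs_sub (v x₀) (F x₀)
    linarith
  have hSne : S.Nonempty := by
    by_contra hne
    rw [Finset.not_nonempty_iff_eq_empty] at hne
    have : F x₀ = 0 := by simp [hF, hne]
    rw [this, abs_zero, hγ] at hFx₀
    linarith
  obtain ⟨i, hi, himax⟩ := S.exists_max_image (fun p => |F p|) hSne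
  have hFi : N - γ ≤ |F i| :=
    hFx₀.trans (hH2.abs_expansion_le hpos S a (abs_nonneg _) himax x₀)
  have hsign : 0 ≤ a i * F i := hH2.coeff_mul_nonneg hpos S a hi himax
  have hai : a i ≠ 0 := (Finset.mem_filter.1 hi).2
  have hvi := abs_le.1 (h1 i)
  have hfib : ∀ y ∈ π ⁻¹' {i}, |v i - v y| < γ := by
    intro y hy
    have hy' : π y = i := hy
    rw [← hy']
    exact hrv ((hπ y).trans_le (min_le_right _ _))
  -- On the fibre of i, v exceeds 1 in absolute value with the sign of F i. Since εq = v₀ − v and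
  -- |v₀| ≤ 1, q has the opposite sign there, and so has its integral a i, against the discrete
  -- maximum principle.
  rcases le_total 0 (F i) with hF0 | hF0
  · rw [abs_of_nonneg hF0] at hFi
    have hneg : a i ≤ 0 := by
      refine integral_nonpos_of_ae ?_
      filter_upwards [ae_restrict_mem (π.measurableSet_fiber i), ae_restrict_of_ae h,
        ae_restrict_of_ae hv₀] with y hy h2 h3
      have e1 := abs_lt.1 (hfib y hy)
      have e2 := abs_le.1 h3
      simp only [Pi.zero_apply]
      have : ε * q y < 0 := by linarith [hvi.1, e1.2]
      nlinarith
    have := lt_of_le_of_ne hneg hai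
    have hFpos : 0 < F i := by linarith
    nlinarith [mul_neg_of_neg_of_pos this hFpos]
  · rw [abs_of_nonpos hF0] at hFi
    have hnonneg : 0 ≤ a i := by
      refine integral_nonneg_of_ae ?_
      filter_upwards [ae_restrict_mem (π.measurableSet_fiber i), ae_restrict_of_ae h,
        ae_restrict_of_ae hv₀] with y hy h2 h3
      have e1 := abs_lt.1 (hfib y hy)
      have e2 := abs_le.1 h3
      simp only [Pi.zero_apply]
      have : 0 < ε * q y := by linarith [hvi.2, e1.1]
      exact (pos_of_mul_pos_right this hε.le).le
    have := lt_of_le_of_ne hnonneg hai.symm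
    have hFneg : F i < 0 := by linarith
    nlinarith [mul_neg_of_pos_of_neg this hFneg]

end Operator

/-! ### Eigenprojections, resolvent and source conditions -/

section Spectral

variable {H : Type*} [NormedAddCommGroup H] [InnerProductSpace ℝ H] [CompleteSpace H]
  {T : H →L[ℝ] H}

theorem apply_eigenProjection (T : H →L[ℝ] H) (μ : ℝ) (h : H) :
    T (eigenProjection T μ h) = μ • eigenProjection T μ h := by
  have : eigenProjection T μ h ∈
      LinearMap.ker (T - μ • ContinuousLinearMap.id ℝ H).toLinearMap :=
    Submodule.starProjection_apply_mem _ h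
  rw [LinearMap.mem_ker] at this
  simpa [sub_eq_zero] using this

theorem inner_eigenProjection_self (T : H →L[ℝ] H) (μ : ℝ) (h : H) :
    inner ℝ (eigenProjection T μ h) h = ‖eigenProjection T μ h‖ ^ 2 := by
  set V := LinearMap.ker (T - μ • ContinuousLinearMap.id ℝ H).toLinearMap
  have h1 : inner ℝ (h - V.starProjection h) (V.starProjection h) = 0 :=
    Submodule.starProjection_inner_eq_zero h _ (Submodule.starProjection_apply_mem _ h)
  change inner ℝ (V.starProjection h) h = ‖V.starProjection h‖ ^ 2
  rw [inner_sub_left, real_inner_self_eq_norm_sq] at h1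
  rw [real_inner_comm]
  linarith

theorem inner_eigenProjection_of_ne (hsym : ∀ f g, inner ℝ (T f) g = inner ℝ f (T g))
    {μ ν : ℝ} (hμν : μ ≠ ν) (h k : H) :
    inner ℝ (eigenProjection T μ h) (eigenProjection T ν k) = 0 := by
  have := hsym (eigenProjection T μ h) (eigenProjection T ν k)
  rw [apply_eigenProjection, apply_eigenProjection, inner_smul_left, inner_smul_right] at this
  simp only [conj_trivial] at this
  have h2 : (μ - ν) * inner ℝ (eigenProjection T μ h) (eigenProjection T ν k) = 0 := by
    linarith
  exact (mul_eq_zero.1 h2).resolve_left (sub_ne_zero.2 hμν)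

theorem eigenvalue_mem_Icc (hnn : ∀ f, 0 ≤ inner ℝ f (T f)) {μ : ℝ} {h : H}
    (hμ : eigenProjection T μ h ≠ 0) : 0 ≤ μ ∧ μ ≤ ‖T‖ := by
  have hn : 0 < ‖eigenProjection T μ h‖ := norm_pos_iff.2 hμ
  have h0 : 0 ≤ μ := by
    have := hnn (eigenProjection T μ h)
    rw [apply_eigenProjection, inner_smul_right, real_inner_self_eq_norm_sq] at this
    exact nonneg_of_mul_nonneg_left this (by positivity)
  refine ⟨h0, ?_⟩
  have := T.le_opNorm (eigenProjection T μ h)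
  rw [apply_eigenProjection, norm_smul, Real.norm_of_nonneg h0] at this
  exact le_of_mul_le_mul_right this hn

theorem norm_sq_sum_eigenProjection (hsym : ∀ f g, inner ℝ (T f) g = inner ℝ f (T g))
    (F : Finset ℝ) (c : ℝ → ℝ) (h : H) :
    ‖∑ μ ∈ F, c μ • eigenProjection T μ h‖ ^ 2
      = ∑ μ ∈ F, c μ ^ 2 * ‖eigenProjection T μ h‖ ^ 2 := by
  rw [← real_inner_self_eq_norm_sq, sum_inner]
  refine Finset.sum_congr rfl fun μ hμ => ?_
  rw [inner_sum, Finset.sum_eq_single μ]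
  · rw [inner_smul_left, inner_smul_right, real_inner_self_eq_norm_sq]
    simp only [conj_trivial]; ring
  · intro ν _ hν
    rw [inner_smul_left, inner_smul_right, inner_eigenProjection_of_ne hsym hν.symm]
    simp
  · exact fun h => absurd hμ h

/-- Bessel's inequality for the eigenprojections. -/
theorem sum_norm_sq_eigenProjection_le (hsym : ∀ f g, inner ℝ (T f) g = inner ℝ f (T g))
    (F : Finset ℝ) (h : H) : ∑ μ ∈ F, ‖eigenProjection T μ h‖ ^ 2 ≤ ‖h‖ ^ 2 := by
  have h1 := norm_sq_sum_eigenProjection hsym F (fun _ => 1) h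
  simp only [one_smul, one_pow, one_mul] at h1
  have h2 : inner ℝ (∑ μ ∈ F, eigenProjection T μ h) h
      = ∑ μ ∈ F, ‖eigenProjection T μ h‖ ^ 2 := by
    rw [sum_inner]
    exact Finset.sum_congr rfl fun μ _ => inner_eigenProjection_self T μ h
  have h3 := real_inner_le_norm (∑ μ ∈ F, eigenProjection T μ h) h
  rw [h2, ← h1] at h3
  rw [← h1]
  set a := ‖∑ μ ∈ F, eigenProjection T μ h‖
  have ha : 0 ≤ a := norm_nonneg _
  have hh : 0 ≤ ‖h‖ := norm_nonneg _
  nlinarith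

/-- Orthogonality of the eigenspaces and Bessel's inequality suffice; completeness of the
eigenvectors plays no role. -/
theorem norm_le_of_hasSum_eigenProjection
    (hsym : ∀ f g, inner ℝ (T f) g = inner ℝ f (T g)) {c : ℝ → ℝ} {C : ℝ} (hC : 0 ≤ C)
    {h g : H} (hc : ∀ μ, eigenProjection T μ h ≠ 0 → |c μ| ≤ C)
    (hg : HasSum (fun μ => c μ • eigenProjection T μ h) g) : ‖g‖ ≤ C * ‖h‖ := by
  refine le_of_tendsto hg.norm (Filter.Eventually.of_forall fun F => ?_)
  refine abs_le_of_sq_le_sq' ?_ (by positivity) |>.2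
  rw [norm_sq_sum_eigenProjection hsym, mul_pow]
  refine le_trans ?_ (mul_le_mul_of_nonneg_left (sum_norm_sq_eigenProjection_le hsym F h)
    (sq_nonneg C))
  rw [Finset.mul_sum]
  refine Finset.sum_le_sum fun μ _ => ?_
  by_cases hμ : eigenProjection T μ h = 0
  · simp [hμ]
  · exact mul_le_mul_of_nonneg_right (sq_le_sq' (neg_le_of_abs_le (hc μ hμ))
      (le_of_abs_le (hc μ hμ))) (sq_nonneg _)

theorem summable_eigenProjection (hsym : ∀ f g, inner ℝ (T f) g = inner ℝ f (T g))
    {c : ℝ → ℝ} {C : ℝ} {h : H} (hc : ∀ μ, eigenProjection T μ h ≠ 0 → |c μ| ≤ C) :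
    Summable fun μ => c μ • eigenProjection T μ h := by
  let V : ℝ → Submodule ℝ H := fun μ =>
    LinearMap.ker (T - μ • ContinuousLinearMap.id ℝ H).toLinearMap
  have hV : OrthogonalFamily ℝ (fun μ => V μ) fun μ => (V μ).subtypeₗᵢ := by
    intro μ ν hμν f g
    have h1 : T (f : H) = μ • (f : H) := by
      have := f.2
      simp only [V, LinearMap.mem_ker] at this
      simpa [sub_eq_zero] using this
    have h2 : T (g : H) = ν • (g : H) := by
      have := g.2
      simp only [V, LinearMap.mem_ker] at this
      simpa [sub_eq_zero] using this
    have := hsym (f : H) (g : H)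
    rw [h1, h2, inner_smul_left, inner_smul_right] at this
    simp only [conj_trivial] at this
    have h3 : (μ - ν) * inner ℝ (f : H) (g : H) = 0 := by linarith
    exact (mul_eq_zero.1 h3).resolve_left (sub_ne_zero.2 hμν)
  have hmem : ∀ μ, c μ • eigenProjection T μ h ∈ V μ := fun μ =>
    (V μ).smul_mem _ (Submodule.starProjection_apply_mem _ h)
  refine (hV.summable_iff_norm_sq_summable fun μ =>
    (⟨c μ • eigenProjection T μ h, hmem μ⟩ : V μ)).2 ?_
  have hs : Summable fun μ => C ^ 2 * ‖eigenProjection T μ h‖ ^ 2 :=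
    (summable_of_sum_le (fun μ => sq_nonneg _)
      fun F => sum_norm_sq_eigenProjection_le hsym F h).mul_left _
  refine hs.of_nonneg_of_le (fun μ => sq_nonneg _) fun μ => ?_
  simp only [Submodule.coe_norm, norm_smul, mul_pow, Real.norm_eq_abs, sq_abs]
  by_cases hμ : eigenProjection T μ h = 0
  · simp [hμ]
  · exact mul_le_mul_of_nonneg_right (sq_le_sq' (neg_le_of_abs_le (hc μ hμ))
      (le_of_abs_le (hc μ hμ))) (sq_nonneg _)

/-- The resolvent `(T + ε)⁻¹` of a positive operator. -/
theorem exists_resolvent (hnn : ∀ f, 0 ≤ inner ℝ f (T f)) {ε : ℝ} (hε : 0 < ε) :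
    ∃ R : H →L[ℝ] H, (∀ v, T (R v) + ε • R v = v) ∧ (∀ v, R (T v + ε • v) = v) ∧
      ∀ v, ‖R v‖ ≤ ε⁻¹ * ‖v‖ := by
  let A : H →L[ℝ] H := T + ε • ContinuousLinearMap.id ℝ H
  have hA : ∀ v, A v = T v + ε • v := fun v => by simp [A]
  have hcoer : ∀ v, ε * ‖v‖ ^ 2 ≤ inner ℝ v (A v) := by
    intro v
    rw [hA, inner_add_right, inner_smul_right, real_inner_self_eq_norm_sq]
    linarith [hnn v]
  have hbelow : ∀ v, ε * ‖v‖ ≤ ‖A v‖ := by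
    intro v
    rcases eq_or_ne v 0 with rfl | hv
    · simp
    · have h1 := (hcoer v).trans (real_inner_le_norm v (A v))
      have h2 : 0 < ‖v‖ := norm_pos_iff.2 hv
      nlinarith
  -- T + ε is inverted by Lax–Milgram, as its form is coercive with constant ε.
  let B : H →L[ℝ] H →L[ℝ] ℝ := LinearMap.mkContinuous₂
    (LinearMap.mk₂ ℝ (fun u v => inner ℝ (A u) v)
      (fun u u' v => by rw [map_add, inner_add_left])
      (fun a u v => by rw [map_smul, inner_smul_left]; rfl)
      (fun u v v' => inner_add_right _ _ _)
      (fun a u v => by rw [inner_smul_right]; rfl)) ‖A‖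
    (fun u v => (norm_inner_le_norm _ _).trans
      (mul_le_mul_of_nonneg_right (A.le_opNorm u) (norm_nonneg _)))
  have hB : ∀ u v, B u v = inner ℝ (A u) v := fun u v => rfl
  have hBc : IsCoercive B := by
    refine ⟨ε, hε, fun u => ?_⟩
    rw [hB, real_inner_comm, mul_assoc, ← pow_two]
    exact hcoer u
  let E := hBc.continuousLinearEquivOfBilin
  have hE : ∀ v, E v = A v := fun v => by
    refine ext_inner_right ℝ fun w => ?_
    rw [hBc.continuousLinearEquivOfBilin_apply, hB]
  refine ⟨E.symm, fun v => ?_, fun v => ?_, fun v => ?_⟩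
  · rw [← hA]
    change A (E.symm v) = v
    rw [← hE, E.apply_symm_apply]
  · rw [← hA, ← hE]
    exact E.symm_apply_apply v
  · have := hbelow (E.symm v)
    rw [← hE, E.apply_symm_apply] at this
    rw [← div_eq_inv_mul, le_div_iff₀ hε]
    change ‖E.symm v‖ * ε ≤ _
    linarith

/-- For μ ≤ ε bound the denominator below by ε; for μ ≥ ε bound it by μ and use that μ^(t−1) is
nonincreasing in μ. -/
theorem rpow_div_add_le {μ ε t : ℝ} (hμ : 0 ≤ μ) (hε : 0 < ε) (ht : 0 ≤ t) (ht1 : t ≤ 1) :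
    μ ^ t / (μ + ε) ≤ ε ^ (t - 1) := by
  rw [div_le_iff₀ (by linarith)]
  rcases le_total μ ε with h | h
  · calc μ ^ t ≤ ε ^ t := Real.rpow_le_rpow hμ h ht
      _ = ε ^ (t - 1) * ε := by
        rw [← Real.rpow_add_one hε.ne', sub_add_cancel]
      _ ≤ ε ^ (t - 1) * (μ + ε) := by gcongr; linarith
  · have hμ' : 0 < μ := hε.trans_le h
    calc μ ^ t = μ ^ (t - 1) * μ := by rw [← Real.rpow_add_one hμ'.ne', sub_add_cancel]
      _ ≤ ε ^ (t - 1) * (μ + ε) := by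
        refine mul_le_mul ?_ (by linarith) hμ (by positivity)
        exact Real.rpow_le_rpow_of_nonpos hε h (by linarith)

/-- The resolvent applied to a vector `T ^ a h`. -/
theorem norm_resolvent_le (hsym : ∀ f g, inner ℝ (T f) g = inner ℝ f (T g))
    (hnn : ∀ f, 0 ≤ inner ℝ f (T f)) {a t ε : ℝ} (ht : 0 ≤ t) (ht1 : t ≤ 1) (hta : t ≤ a)
    (hε : 0 < ε) {h g p : H} (hg : HasSum (fun μ : ℝ => μ ^ a • eigenProjection T μ h) g)
    (hp : T p + ε • p = g) : ‖p‖ ≤ ‖T‖ ^ (a - t) * ε ^ (t - 1) * ‖h‖ := by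
  obtain ⟨R, -, hR, -⟩ := exists_resolvent hnn hε
  have h1 : HasSum (fun μ : ℝ => (μ ^ a / (μ + ε)) • eigenProjection T μ h) p := by
    have h2 := hg.mapL R
    rw [← hp, hR] at h2
    refine h2.congr_fun fun μ => ?_
    by_cases hμ : eigenProjection T μ h = 0
    · simp [hμ]
    · have hμ0 := (eigenvalue_mem_Icc hnn hμ).1
      have h3 := hR (eigenProjection T μ h)
      rw [apply_eigenProjection, ← add_smul, map_smul] at h3
      rw [map_smul]
      nth_rewrite 1 [← h3]
      rw [smul_smul, div_mul_cancel₀ _ (by positivity)]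
  refine norm_le_of_hasSum_eigenProjection hsym (by positivity) (fun μ hμ => ?_) h1
  obtain ⟨hμ0, hμT⟩ := eigenvalue_mem_Icc hnn hμ
  rw [abs_of_nonneg (by positivity)]
  have : μ ^ a = μ ^ (a - t) * μ ^ t := by
    rw [← Real.rpow_add_of_nonneg hμ0 (by linarith) ht, sub_add_cancel]
  rw [this, mul_div_assoc]
  exact mul_le_mul (Real.rpow_le_rpow hμ0 hμT (by linarith)) (rpow_div_add_le hμ0 hε ht ht1)
    (by positivity) (by positivity)

/-- Lowering the exponent by 1 keeps the multipliers bounded on the spectrum. For s = 1 the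
eigenvalue 0 has multiplier 0^0 = 1, which is harmless because T kills that component. -/
theorem exists_preimage_of_one_le (hsym : ∀ f g, inner ℝ (T f) g = inner ℝ f (T g))
    (hnn : ∀ f, 0 ≤ inner ℝ f (T f)) {s : ℝ} (hs : 1 ≤ s) {h g : H}
    (hg : HasSum (fun μ : ℝ => μ ^ s • eigenProjection T μ h) g) :
    ∃ g₀, T g₀ = g ∧ HasSum (fun μ : ℝ => μ ^ (s - 1) • eigenProjection T μ h) g₀ := by
  have hsum : Summable fun μ : ℝ => μ ^ (s - 1) • eigenProjection T μ h := by
    refine summable_eigenProjection hsym (C := ‖T‖ ^ (s - 1)) fun μ hμ => ?_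
    obtain ⟨hμ0, hμT⟩ := eigenvalue_mem_Icc hnn hμ
    rw [abs_of_nonneg (by positivity)]
    exact Real.rpow_le_rpow hμ0 hμT (by linarith)
  obtain ⟨g₀, hg₀⟩ := hsum
  refine ⟨g₀, ?_, hg₀⟩
  refine (hg₀.mapL T).unique (hg.congr_fun fun μ => ?_)
  by_cases hμ : eigenProjection T μ h = 0
  · simp [hμ]
  · have hμ0 := (eigenvalue_mem_Icc hnn hμ).1
    rw [map_smul, apply_eigenProjection, smul_smul]
    congr 1
    nth_rewrite 2 [← Real.rpow_one μ]
    rw [← Real.rpow_add_of_nonneg hμ0 (by linarith) zero_le_one, sub_add_cancel]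

end Spectral

/-! ### Minimizers: ℓ¹ bound and comparison by interpolation -/

theorem IsL1Minimizer.sum_abs_le {X : Type*} {K : X → X → ℝ} {m : ℕ} {z : Fin m → X × ℝ} {lam M : ℝ}
    (hm : 1 ≤ m) (hlam : 0 < lam) (hz : ∀ j, |(z j).2| ≤ M) {c : Fin m → ℝ}
    (hc : IsL1Minimizer K z lam c) : ∑ j, |c j| ≤ M ^ 2 / lam := by
  have h := hc 0
  have hm' : (0 : ℝ) < m := by exact_mod_cast hm
  simp only [l1Objective, kernelExpansion, Pi.zero_apply, zero_mul, Finset.sum_const_zero,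
    zero_sub, neg_sq, abs_zero, mul_zero, add_zero] at h
  rw [le_div_iff₀ hlam, mul_comm]
  have h1 : (1 / (m : ℝ)) * ∑ j, (z j).2 ^ 2 ≤ M ^ 2 := by
    rw [one_div, inv_mul_le_iff₀ hm']
    calc ∑ j, (z j).2 ^ 2 ≤ ∑ _j : Fin m, M ^ 2 :=
          Finset.sum_le_sum fun j _ => sq_le_sq' (neg_le_of_abs_le (hz j)) (le_of_abs_le (hz j))
      _ = m * M ^ 2 := by simp
  have h2 : 0 ≤ (1 / (m : ℝ)) * ∑ j, ((∑ i, c i * K (z i).1 (z j).1) - (z j).2) ^ 2 := by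
    positivity
  linarith

section Minimizer

variable {X : Type*} [MetricSpace X] [CompactSpace X] [MeasurableSpace X] [BorelSpace X]
  (ν : Measure X) [IsFiniteMeasure ν] {K : C(X × X, ℝ)}

/-- A function `∫ K(t, ·) p(t) dν(t)` agrees at given points with a kernel expansion whose
coefficients have `ℓ¹` norm at most `∫ |p| dν`. -/
theorem exists_interpolation (hpos : IsPosDefKernel fun x t => K (x, t))
    (hH2 : ConditionH2 fun x t => K (x, t)) (p : Lp ℝ 2 ν) {m : ℕ} (x : Fin m → X) :
    ∃ c : Fin m → ℝ, (∀ i, ∑ j, c j * K (x j, x i) = integralTransform ν K p (x i)) ∧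
      ∑ j, |c j| ≤ ∫ t, |p t| ∂ν := by
  classical
  set v := integralTransform ν K p with hv
  have hp := integrable_of_Lp ν p
  obtain ⟨B, -, hB1, hB2, -⟩ := hH2.exists_inverse hpos (Finset.univ.image x)
  obtain ⟨c, hc, hc'⟩ := exists_coeff_of_finset (K := fun x t => K (x, t)) x
    fun r => ∑ q ∈ Finset.univ.image x, B r q * v q
  refine ⟨c, fun i => ?_, ?_⟩
  · rw [hc (x i)]
    exact hB2 v (x i) (by simp)
  · rw [hc']
    have hint : ∀ r q, Integrable (fun t => B r q * K (t, q) * p t) ν := fun r q => by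
      simp_rw [mul_assoc]
      exact (integrable_kernel_mul ν K p hp q).const_mul _
    -- The coefficients of the interpolant of v are the integrals against p of those interpolating
    -- the sections K(t, ·); for each t the latter have ℓ¹ norm at most 1.
    have h1 : ∀ r, ∑ q ∈ Finset.univ.image x, B r q * v q
        = ∫ t, (∑ q ∈ Finset.univ.image x, B r q * K (t, q)) * p t ∂ν := by
      intro r
      simp_rw [Finset.sum_mul]
      rw [integral_finsetSum _ fun q _ => hint r q]
      refine Finset.sum_congr rfl fun q _ => ?_
      simp_rw [mul_assoc]
      rw [integral_const_mul]
      rfl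
    have hint' : ∀ r, Integrable
        (fun t => (∑ q ∈ Finset.univ.image x, B r q * K (t, q)) * p t) ν := fun r => by
      simp_rw [Finset.sum_mul]
      exact integrable_finsetSum _ fun q _ => hint r q
    calc ∑ r ∈ Finset.univ.image x, |∑ q ∈ Finset.univ.image x, B r q * v q|
        ≤ ∑ r ∈ Finset.univ.image x,
            ∫ t, |(∑ q ∈ Finset.univ.image x, B r q * K (t, q)) * p t| ∂ν := by
          refine Finset.sum_le_sum fun r _ => ?_
          rw [h1]
          exact abs_integral_le_integral_abs
      _ = ∫ t, ∑ r ∈ Finset.univ.image x,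
            |(∑ q ∈ Finset.univ.image x, B r q * K (t, q)) * p t| ∂ν :=
          (integral_finsetSum _ fun r _ => (hint' r).abs).symm
      _ ≤ ∫ t, |p t| ∂ν := by
          refine integral_mono (integrable_finsetSum _ fun r _ => (hint' r).abs) hp.abs
            fun t => ?_
          simp only [abs_mul, ← Finset.sum_mul]
          exact mul_le_of_le_one_left (abs_nonneg _) (hB1 t)

/-- The competitor is an expansion over the same sample that equals the transform of p at all sample
points, so replacing the transform by it costs nothing in the empirical error. -/
theorem IsL1Minimizer.objective_le (hpos : IsPosDefKernel fun x t => K (x, t))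
    (hH2 : ConditionH2 fun x t => K (x, t)) (p : Lp ℝ 2 ν) {m : ℕ} {z : Fin m → X × ℝ}
    {lam : ℝ} (hlam : 0 ≤ lam) {c : Fin m → ℝ}
    (hc : IsL1Minimizer (fun x t => K (x, t)) z lam c) :
    l1Objective (fun x t => K (x, t)) z lam c
      ≤ (1 / (m : ℝ)) * ∑ j, (integralTransform ν K p (z j).1 - (z j).2) ^ 2
        + lam * ∫ t, |p t| ∂ν := by
  obtain ⟨c', hc', hc1⟩ := exists_interpolation ν hpos hH2 p fun j => (z j).1
  refine (hc c').trans ?_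
  unfold l1Objective kernelExpansion
  simp_rw [hc']
  gcongr

end Minimizer

/-! ### Bernstein bounds under a variance condition -/

section Concentration

variable {Ω : Type*} [MeasurableSpace Ω] {P : Measure Ω} [IsProbabilityMeasure P]

theorem integral_exp_le_of_abs_le_one {u : Ω → ℝ} (hu : Measurable u)
    (hb : ∀ᵐ ω ∂P, |u ω| ≤ 1) :
    ∫ ω, Real.exp (u ω) ∂P ≤ Real.exp (∫ ω, u ω ∂P + ∫ ω, u ω ^ 2 ∂P) := by
  have hi : Integrable u P := Integrable.of_bound hu.aestronglyMeasurable 1 hb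
  have hi2 : Integrable (fun ω => u ω ^ 2) P := by
    refine Integrable.of_bound (hu.pow_const 2).aestronglyMeasurable 1 ?_
    filter_upwards [hb] with ω hω
    rw [Real.norm_eq_abs, abs_pow]
    exact pow_le_one₀ (abs_nonneg _) hω
  have hie : Integrable (fun ω => Real.exp (u ω)) P := by
    refine Integrable.of_bound hu.exp.aestronglyMeasurable (Real.exp 1) ?_
    filter_upwards [hb] with ω hω
    rw [Real.norm_eq_abs, Real.abs_exp]
    exact Real.exp_le_exp.2 (le_of_abs_le hω)
  calc ∫ ω, Real.exp (u ω) ∂P ≤ ∫ ω, (1 + (u ω + u ω ^ 2)) ∂P := by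
        refine integral_mono_ae hie ((integrable_const _).add (hi.add hi2)) ?_
        filter_upwards [hb] with ω hω
        have := (abs_le.1 (Real.abs_exp_sub_one_sub_id_le hω)).2
        linarith
    _ = (∫ ω, u ω ∂P + ∫ ω, u ω ^ 2 ∂P) + 1 := by
        have h1 : ∫ ω, (1 + (u ω + u ω ^ 2)) ∂P = ∫ ω, (1 : ℝ) ∂P + ∫ ω, (u ω + u ω ^ 2) ∂P :=
          integral_add (integrable_const _) (hi.add hi2)
        rw [h1, integral_add hi hi2]
        simp [add_comm]
    _ ≤ _ := Real.add_one_le_exp _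

/-- Chernoff's method with parameter 1: the scale of the exponential moment is already contained in
u. -/
theorem measure_sum_ge_le {u : Ω → ℝ} (hu : Measurable u) (hb : ∀ᵐ ω ∂P, |u ω| ≤ 1)
    {m : ℕ} (x : ℝ) :
    (Measure.pi fun _ : Fin m => P).real
      {z | m * (∫ ω, u ω ∂P + ∫ ω, u ω ^ 2 ∂P) + x ≤ ∑ j, u (z j)} ≤ Real.exp (-x) := by
  set A := ∫ ω, u ω ∂P + ∫ ω, u ω ^ 2 ∂P with hA
  set Q := Measure.pi fun _ : Fin m => P
  have hE : ∫ z, ∏ j : Fin m, Real.exp (u (z j)) ∂Q ≤ Real.exp (m * A) := by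
    rw [integral_fintype_prod_eq_prod (fun (_ : Fin m) ω => Real.exp (u ω))]
    rw [Finset.prod_const, Finset.card_univ, Fintype.card_fin, Real.exp_nat_mul]
    exact pow_le_pow_left₀ (integral_nonneg fun _ => (Real.exp_pos _).le)
      (integral_exp_le_of_abs_le_one hu hb) m
  have hie : Integrable (fun z : Fin m → Ω => ∏ j, Real.exp (u (z j))) Q := by
    refine Integrable.fintype_prod (f := fun (_ : Fin m) ω => Real.exp (u ω)) fun _ => ?_
    refine Integrable.of_bound hu.exp.aestronglyMeasurable (Real.exp 1) ?_
    filter_upwards [hb] with ω hω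
    rw [Real.norm_eq_abs, Real.abs_exp]
    exact Real.exp_le_exp.2 (le_of_abs_le hω)
  have hM := mul_meas_ge_le_integral_of_nonneg
    (Filter.Eventually.of_forall fun z => Finset.prod_nonneg fun j _ => (Real.exp_pos _).le) hie
    (Real.exp (m * A + x))
  have hset : {z : Fin m → Ω | Real.exp (m * A + x) ≤ ∏ j, Real.exp (u (z j))}
      = {z | m * A + x ≤ ∑ j, u (z j)} := by
    ext z
    simp only [Set.mem_ofPred_eq, ← Real.exp_sum, Real.exp_le_exp]
  rw [hset] at hM
  have h1 := hM.trans hE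
  have h2 : Real.exp (m * A) = Real.exp (m * A + x) * Real.exp (-x) := by
    rw [← Real.exp_add]; congr 1; ring
  rw [h2] at h1
  exact le_of_mul_le_mul_left h1 (Real.exp_pos _)

/-- One-sided Bernstein inequality under the variance bound `E ζ² ≤ B E ζ`: the expectation is
controlled by the sample mean. -/
theorem measure_expectation_gt_le {ζ : Ω → ℝ} (hζ : Measurable ζ) {B : ℝ} (hB : 0 < B)
    (hb : ∀ᵐ ω ∂P, |ζ ω| ≤ B) (hvar : ∫ ω, ζ ω ^ 2 ∂P ≤ B * ∫ ω, ζ ω ∂P)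
    {m : ℕ} (hm : 1 ≤ m) (x : ℝ) :
    (Measure.pi fun _ : Fin m => P).real
      {z | 2 * ((1 / (m : ℝ)) * ∑ j, ζ (z j)) + 4 * B * x / m < ∫ ω, ζ ω ∂P}
      ≤ Real.exp (-x) := by
  have hm' : (0 : ℝ) < m := by exact_mod_cast hm
  set e := ∫ ω, ζ ω ∂P with he
  -- With u = −ζ/(2B), the variance condition bounds the second moment of u by half of |E u|,
  -- leaving the drift −E ζ/(4B).
  refine le_trans (measureReal_mono ?_)
    (measure_sum_ge_le (P := P) (u := fun ω => -(1 / (2 * B)) * ζ ω) (by fun_prop) ?_ x)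
  · intro z hz
    simp only [Set.mem_ofPred_eq] at hz ⊢
    simp_rw [mul_pow]
    rw [integral_const_mul, integral_const_mul, ← Finset.mul_sum, ← he]
    have h1 : (-(1 / (2 * B))) ^ 2 * ∫ ω, ζ ω ^ 2 ∂P ≤ (1 / (4 * B)) * e := by
      calc (-(1 / (2 * B))) ^ 2 * ∫ ω, ζ ω ^ 2 ∂P ≤ (-(1 / (2 * B))) ^ 2 * (B * e) := by gcongr
        _ = (1 / (4 * B)) * e := by field_simp; ring
    have h2 : m * (-(1 / (2 * B)) * e + (-(1 / (2 * B))) ^ 2 * ∫ ω, ζ ω ^ 2 ∂P)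
        ≤ m * (-(1 / (2 * B)) * e + (1 / (4 * B)) * e) := by gcongr
    have h3 := mul_lt_mul_of_pos_left hz (show 0 < m / (4 * B) by positivity)
    have h4 : m / (4 * B) * (2 * (1 / (m : ℝ) * ∑ j, ζ (z j)) + 4 * B * x / m)
        = 1 / (2 * B) * ∑ j, ζ (z j) + x := by field_simp; ring
    have h5 : m * (-(1 / (2 * B)) * e + (1 / (4 * B)) * e) = -(m / (4 * B) * e) := by
      field_simp; ring
    linarith
  · filter_upwards [hb] with ω hω
    rw [abs_mul, abs_neg, abs_of_pos (by positivity), one_div, inv_mul_le_iff₀ (by positivity)]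
    linarith

theorem measure_mean_gt_le {ζ : Ω → ℝ} (hζ : Measurable ζ) {B : ℝ} (hB : 0 < B)
    (hb : ∀ᵐ ω ∂P, |ζ ω| ≤ B) (hvar : ∫ ω, ζ ω ^ 2 ∂P ≤ B * ∫ ω, ζ ω ∂P)
    {m : ℕ} (hm : 1 ≤ m) {x : ℝ} (hx : 0 ≤ x) :
    (Measure.pi fun _ : Fin m => P).real
      {z | 2 * ∫ ω, ζ ω ∂P + 4 * B * x / m < (1 / (m : ℝ)) * ∑ j, ζ (z j)}
      ≤ Real.exp (-x) := by
  have hm' : (0 : ℝ) < m := by exact_mod_cast hm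
  set e := ∫ ω, ζ ω ∂P with he
  have he0 : 0 ≤ e := nonneg_of_mul_nonneg_right
    ((integral_nonneg fun ω => sq_nonneg (ζ ω)).trans hvar) hB
  refine le_trans (measureReal_mono ?_)
    (measure_sum_ge_le (P := P) (u := fun ω => (1 / (2 * B)) * ζ ω) (by fun_prop) ?_ x)
  · intro z hz
    simp only [Set.mem_ofPred_eq] at hz ⊢
    simp_rw [mul_pow]
    rw [integral_const_mul, integral_const_mul, ← Finset.mul_sum, ← he]
    have h1 : (1 / (2 * B)) ^ 2 * ∫ ω, ζ ω ^ 2 ∂P ≤ (1 / (4 * B)) * e := by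
      calc (1 / (2 * B)) ^ 2 * ∫ ω, ζ ω ^ 2 ∂P ≤ (1 / (2 * B)) ^ 2 * (B * e) := by gcongr
        _ = (1 / (4 * B)) * e := by field_simp; ring
    have h2 : m * (1 / (2 * B) * e + (1 / (2 * B)) ^ 2 * ∫ ω, ζ ω ^ 2 ∂P)
        ≤ m * (1 / (2 * B) * e + (1 / (4 * B)) * e) := by gcongr
    have h3 := mul_lt_mul_of_pos_left hz (show 0 < m / (2 * B) by positivity)
    have h4 : m / (2 * B) * (1 / (m : ℝ) * ∑ j, ζ (z j)) = 1 / (2 * B) * ∑ j, ζ (z j) := by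
      field_simp
    have h5 : m / (2 * B) * (2 * e + 4 * B * x / m) = m / B * e + 2 * x := by field_simp; ring
    have h6 : m * (1 / (2 * B) * e + (1 / (4 * B)) * e) = 3 / 4 * (m / B * e) := by
      field_simp; ring
    have h7 : 0 ≤ m / B * e := by positivity
    linarith
  · filter_upwards [hb] with ω hω
    rw [abs_mul, abs_of_pos (by positivity), one_div, inv_mul_le_iff₀ (by positivity)]
    linarith

end Concentration

/-! ### Excess loss: mean and variance -/

section Excess

variable {X : Type*} [MeasurableSpace X] (ρ : Measure (X × ℝ)) [IsProbabilityMeasure ρ]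

/-- The excess loss of `f` over the regression function. -/
def excessLoss (f : X → ℝ) (z : X × ℝ) : ℝ :=
  (f z.1 - z.2) ^ 2 - (regressionFunction ρ z.1 - z.2) ^ 2

theorem measurable_regressionFunction : Measurable (regressionFunction ρ) := by
  have : StronglyMeasurable fun x => ∫ y, (fun (_ : X) (y : ℝ) => y) x y ∂(ρ.condKernel x) :=
    StronglyMeasurable.integral_kernel_prod_right (by
      exact measurable_snd.stronglyMeasurable)
  exact this.measurable

variable {ρ} {M : ℝ}

theorem measurable_excessLoss {f : X → ℝ} (hf : Measurable f) : Measurable (excessLoss ρ f) := by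
  have := measurable_regressionFunction ρ
  unfold excessLoss
  fun_prop

theorem abs_regressionFunction_le (hbounded : ∀ᵐ z ∂ρ, |z.2| ≤ M) :
    ∀ᵐ x ∂ρ.fst, |regressionFunction ρ x| ≤ M := by
  rw [← ρ.disintegrate ρ.condKernel] at hbounded
  filter_upwards [Measure.ae_ae_of_ae_compProd hbounded] with x hx
  have := norm_integral_le_of_norm_le_const (f := fun y : ℝ => y) (C := M) hx
  simpa [regressionFunction] using this

theorem abs_regressionFunction_fst_le (hbounded : ∀ᵐ z ∂ρ, |z.2| ≤ M) :
    ∀ᵐ z ∂ρ, |regressionFunction ρ z.1| ≤ M := by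
  have h := abs_regressionFunction_le hbounded
  rw [Measure.fst] at h
  exact ae_of_ae_map measurable_fst.aemeasurable h

theorem integral_fst_eq {X : Type*} [MeasurableSpace X] {ρ : Measure (X × ℝ)} {φ : X → ℝ} (hφ : Measurable φ) :
    ∫ z, φ z.1 ∂ρ = ∫ x, φ x ∂ρ.fst := by
  rw [Measure.fst, integral_map measurable_fst.aemeasurable hφ.aestronglyMeasurable]

/-- By disintegration, the residual has conditional mean zero and is orthogonal to bounded functions
of x. -/
theorem integral_mul_regressionFunction_sub (hbounded : ∀ᵐ z ∂ρ, |z.2| ≤ M) {φ : X → ℝ}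
    (hφ : Measurable φ) {A : ℝ} (hA : ∀ᵐ z ∂ρ, |φ z.1| ≤ A) :
    ∫ z, φ z.1 * (regressionFunction ρ z.1 - z.2) ∂ρ = 0 := by
  have hr := measurable_regressionFunction ρ
  have h1 : Integrable (fun z : X × ℝ => φ z.1 * z.2) ρ := by
    refine Integrable.of_bound (by fun_prop) (A * M) ?_
    filter_upwards [hbounded, hA] with z h h'
    rw [norm_mul]
    exact mul_le_mul h' h (abs_nonneg _) ((abs_nonneg _).trans h')
  have h2 : Integrable (fun z : X × ℝ => φ z.1 * regressionFunction ρ z.1) ρ := by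
    refine Integrable.of_bound (by fun_prop) (A * M) ?_
    filter_upwards [abs_regressionFunction_fst_le hbounded, hA] with z h h'
    rw [norm_mul]
    exact mul_le_mul h' h (abs_nonneg _) ((abs_nonneg _).trans h')
  simp_rw [mul_sub]
  rw [integral_sub h2 h1, ← Measure.integral_condKernel h1,
    integral_fst_eq (φ := fun x => φ x * regressionFunction ρ x) (by fun_prop), sub_eq_zero]
  refine integral_congr_ae (Filter.Eventually.of_forall fun x => ?_)
  simp only [regressionFunction]
  exact (integral_const_mul _ _).symm

/-- The difference of squares factors as (f − f_ρ)(f + f_ρ − 2y), and both factors are at most A +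
3M in absolute value. -/
theorem abs_excessLoss_le (hbounded : ∀ᵐ z ∂ρ, |z.2| ≤ M) {f : X → ℝ} {A : ℝ}
    (hA : ∀ x, |f x| ≤ A) :
    ∀ᵐ z ∂ρ, |excessLoss ρ f z| ≤ (A + 3 * M) ^ 2 ∧
      excessLoss ρ f z ^ 2 ≤ (A + 3 * M) ^ 2 * (f z.1 - regressionFunction ρ z.1) ^ 2 := by
  filter_upwards [hbounded, abs_regressionFunction_fst_le hbounded] with z h1 h2
  have h3 := hA z.1
  have hfac : excessLoss ρ f z = (f z.1 - regressionFunction ρ z.1)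
      * (f z.1 + regressionFunction ρ z.1 - 2 * z.2) := by
    unfold excessLoss; ring
  have hM : 0 ≤ M := (abs_nonneg _).trans h1
  have hA0 : 0 ≤ A := (abs_nonneg _).trans h3
  rw [abs_le] at h1 h2 h3
  have e1 : |f z.1 - regressionFunction ρ z.1| ≤ A + 3 * M := abs_le.2 ⟨by linarith, by linarith⟩
  have e2 : |f z.1 + regressionFunction ρ z.1 - 2 * z.2| ≤ A + 3 * M :=
    abs_le.2 ⟨by linarith, by linarith⟩
  rw [hfac]
  constructor
  · rw [abs_mul, pow_two]
    exact mul_le_mul e1 e2 (abs_nonneg _) (by linarith)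
  · rw [mul_pow, mul_comm]
    exact mul_le_mul_of_nonneg_right (sq_le_sq' (neg_le_of_abs_le e2) (le_of_abs_le e2))
      (sq_nonneg _)

theorem integral_excessLoss (hbounded : ∀ᵐ z ∂ρ, |z.2| ≤ M) {f : X → ℝ} (hf : Measurable f)
    {A : ℝ} (hA : ∀ x, |f x| ≤ A) :
    ∫ z, excessLoss ρ f z ∂ρ = ∫ x, (f x - regressionFunction ρ x) ^ 2 ∂ρ.fst := by
  have hr := measurable_regressionFunction ρ
  have hb : ∀ᵐ z ∂ρ, |f z.1 - regressionFunction ρ z.1| ≤ A + M := by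
    filter_upwards [abs_regressionFunction_fst_le hbounded] with z h
    exact (abs_sub _ _).trans (add_le_add (hA z.1) h)
  rw [← integral_fst_eq (φ := fun x => (f x - regressionFunction ρ x) ^ 2) (by fun_prop)]
  have h0 := integral_mul_regressionFunction_sub hbounded
    (φ := fun x => f x - regressionFunction ρ x) (by fun_prop) hb
  have h1 : Integrable (fun z : X × ℝ => (f z.1 - regressionFunction ρ z.1) ^ 2) ρ := by
    refine Integrable.of_bound (by fun_prop) ((A + M) ^ 2) ?_
    filter_upwards [hb] with z h
    rw [norm_pow]
    exact pow_le_pow_left₀ (norm_nonneg _) h 2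
  have h2 : Integrable (fun z : X × ℝ => (f z.1 - regressionFunction ρ z.1)
      * (regressionFunction ρ z.1 - z.2)) ρ := by
    refine Integrable.of_bound (by fun_prop) ((A + M) * (2 * M)) ?_
    filter_upwards [hb, hbounded, abs_regressionFunction_fst_le hbounded] with z h h' h''
    rw [norm_mul]
    refine mul_le_mul h ?_ (norm_nonneg _) ((abs_nonneg _).trans h)
    rw [Real.norm_eq_abs]
    exact (abs_sub _ _).trans (by linarith)
  have : ∀ z, excessLoss ρ f z = (f z.1 - regressionFunction ρ z.1) ^ 2
      + 2 * ((f z.1 - regressionFunction ρ z.1) * (regressionFunction ρ z.1 - z.2)) := by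
    intro z; unfold excessLoss; ring
  simp_rw [this]
  rw [integral_add h1 (h2.const_mul 2), integral_const_mul, h0, mul_zero, add_zero]

theorem integral_excessLoss_sq_le (hbounded : ∀ᵐ z ∂ρ, |z.2| ≤ M) {f : X → ℝ}
    (hf : Measurable f) {A : ℝ} (hA : ∀ x, |f x| ≤ A) :
    ∫ z, excessLoss ρ f z ^ 2 ∂ρ ≤ (A + 3 * M) ^ 2 * ∫ z, excessLoss ρ f z ∂ρ := by
  have hr := measurable_regressionFunction ρ
  rw [integral_excessLoss hbounded hf hA,
    ← integral_fst_eq (φ := fun x => (f x - regressionFunction ρ x) ^ 2) (by fun_prop),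
    ← integral_const_mul]
  have hm := measurable_excessLoss (ρ := ρ) hf
  refine integral_mono_ae ?_ ?_ ?_
  · refine Integrable.of_bound (by fun_prop) (((A + 3 * M) ^ 2) ^ 2) ?_
    filter_upwards [abs_excessLoss_le hbounded hA] with z h
    rw [norm_pow]
    exact pow_le_pow_left₀ (norm_nonneg _) h.1 2
  · refine Integrable.const_mul ?_ _
    refine Integrable.of_bound (by fun_prop) ((A + M) ^ 2) ?_
    filter_upwards [abs_regressionFunction_fst_le hbounded] with z h
    rw [norm_pow]
    exact pow_le_pow_left₀ (norm_nonneg _)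
      ((abs_sub _ _).trans (add_le_add (hA z.1) h)) 2
  · filter_upwards [abs_excessLoss_le hbounded hA] with z h using h.2

theorem generalizationError_sub (hbounded : ∀ᵐ z ∂ρ, |z.2| ≤ M) {f : X → ℝ}
    (hf : Measurable f) {A : ℝ} (hA : ∀ x, |f x| ≤ A) :
    generalizationError ρ f - generalizationError ρ (regressionFunction ρ)
      = ∫ z, excessLoss ρ f z ∂ρ := by
  have hr := measurable_regressionFunction ρ
  unfold generalizationError excessLoss
  rw [integral_sub]
  · refine Integrable.of_bound (by fun_prop) ((A + M) ^ 2) ?_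
    filter_upwards [hbounded] with z h
    rw [norm_pow]
    exact pow_le_pow_left₀ (norm_nonneg _) ((abs_sub _ _).trans (add_le_add (hA z.1) h)) 2
  · refine Integrable.of_bound (by fun_prop) ((M + M) ^ 2) ?_
    filter_upwards [hbounded, abs_regressionFunction_fst_le hbounded] with z h h'
    rw [norm_pow]
    exact pow_le_pow_left₀ (norm_nonneg _) ((abs_sub _ _).trans (add_le_add h' h)) 2

end Excess

/-! ### Finite nets of the ℓ¹ ball of kernel expansions -/

section Net

variable {X : Type*}

theorem exists_grid_approx {G : ℕ} (hG : 1 ≤ G) {R b : ℝ} (hR : 0 < R) (hb : |b| ≤ R) :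
    ∃ k : Fin (2 * G + 1), |((k : ℕ) - (G : ℝ)) * (R / G) - b| ≤ R / G := by
  have hG' : (0 : ℝ) < G := by exact_mod_cast hG
  rw [abs_le] at hb
  set u := b * G / R + G with hu
  have hu0 : 0 ≤ u := by
    have : -(G : ℝ) ≤ b * G / R := by
      rw [le_div_iff₀ hR]; nlinarith
    linarith
  have hu1 : u ≤ 2 * G := by
    have : b * G / R ≤ (G : ℝ) := by
      rw [div_le_iff₀ hR]; nlinarith
    linarith
  have hk : ⌊u⌋₊ < 2 * G + 1 := by
    have : ⌊u⌋₊ ≤ 2 * G := Nat.floor_le_of_le (by push_cast; exact hu1)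
    omega
  refine ⟨⟨⌊u⌋₊, hk⟩, ?_⟩
  simp only
  have h1 := Nat.floor_le hu0
  have h2 := Nat.lt_floor_add_one u
  have h3 : b = (u - G) * (R / G) := by rw [hu]; field_simp; ring
  rw [h3]
  rw [← sub_mul, abs_mul, abs_of_pos (div_pos hR hG')]
  refine mul_le_of_le_one_left (div_pos hR hG').le (abs_le.2 ⟨by linarith, by linarith⟩)

/-- Kernel expansions over the points of `T` with coefficients on a grid of step `R / G`. -/
def gridExpansion (K : X → X → ℝ) (T : Finset X) (R : ℝ) (G : ℕ) (k : T → Fin (2 * G + 1))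
    (x : X) : ℝ :=
  ∑ t : T, ((k t : ℕ) - (G : ℝ)) * (R / G) * K t x

theorem exists_gridExpansion_approx {K : X → X → ℝ} {T : Finset X} (hT : T.Nonempty) {ω κ : ℝ}
    (hω : 0 ≤ ω) (hT' : ∀ x, ∃ t ∈ T, ∀ y, |K x y - K t y| ≤ ω) (hκ : ∀ x y, |K x y| ≤ κ)
    {R : ℝ} (hR : 0 < R) {m : ℕ} (hm : 1 ≤ m) {n : ℕ} (x : Fin n → X) {c : Fin n → ℝ}
    (hc : ∑ j, |c j| ≤ R) :
    ∃ k, ∀ y, |∑ j, c j * K (x j) y - gridExpansion K T R (m * T.card) k y|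
      ≤ R * (ω + κ / m) := by
  classical
  have hN : 1 ≤ T.card := hT.card_pos
  have hG : 1 ≤ m * T.card := Nat.mul_pos hm hN
  choose τ hτ hτ' using fun j => hT' (x j)
  -- Each node is moved to a nearby centre and the coefficients arriving at one centre are added up,
  -- so the number of coefficients depends on T and not on the sample.
  let b : T → ℝ := fun t => ∑ j, if τ j = t then c j else 0
  have hb : ∀ t, |b t| ≤ R := fun t => by
    refine (Finset.abs_sum_le_sum_abs _ _).trans (le_trans (Finset.sum_le_sum fun j _ => ?_) hc)
    split_ifs
    · exact le_rfl
    · simp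
  choose k hk using fun t => exists_grid_approx hG hR (hb t)
  refine ⟨k, fun y => ?_⟩
  have h1 : ∑ t : T, b t * K t y = ∑ j, c j * K (τ j) y := by
    simp only [b, Finset.sum_mul]
    rw [Finset.sum_comm]
    refine Finset.sum_congr rfl fun j _ => ?_
    rw [Finset.sum_eq_single (⟨τ j, hτ j⟩ : T)]
    · simp
    · intro t _ ht
      rw [if_neg, zero_mul]
      rintro h
      exact ht (Subtype.ext h.symm)
    · simp
  have hκ0 : 0 ≤ κ := (abs_nonneg _).trans (hκ y y)
  have h2 : |∑ j, c j * K (x j) y - ∑ t : T, b t * K t y| ≤ R * ω := by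
    rw [h1, ← Finset.sum_sub_distrib]
    refine (Finset.abs_sum_le_sum_abs _ _).trans ?_
    calc ∑ j, |c j * K (x j) y - c j * K (τ j) y| ≤ ∑ j, |c j| * ω := by
          refine Finset.sum_le_sum fun j _ => ?_
          rw [← mul_sub, abs_mul]
          exact mul_le_mul_of_nonneg_left (hτ' j y) (abs_nonneg _)
      _ = (∑ j, |c j|) * ω := by rw [Finset.sum_mul]
      _ ≤ R * ω := mul_le_mul_of_nonneg_right hc hω
  -- Grid step R/(m·|T|): the |T| rounding errors add up to at most Rκ/m.
  have h3 : |∑ t : T, b t * K t y - gridExpansion K T R (m * T.card) k y| ≤ R * (κ / m) := by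
    unfold gridExpansion
    rw [← Finset.sum_sub_distrib]
    refine (Finset.abs_sum_le_sum_abs _ _).trans ?_
    calc ∑ t : T, |b t * K t y - ((k t : ℕ) - ((m * T.card : ℕ) : ℝ))
            * (R / (m * T.card : ℕ)) * K t y|
        ≤ ∑ _t : T, R / (m * T.card : ℕ) * κ := by
          refine Finset.sum_le_sum fun t _ => ?_
          rw [← sub_mul, abs_mul, abs_sub_comm]
          exact mul_le_mul (hk t) (hκ _ _) (abs_nonneg _) (by positivity)
      _ = R * (κ / m) := by
          have h4 : (T.card : ℝ) ≠ 0 := by positivity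
          have h5 : (m : ℝ) ≠ 0 := by positivity
          rw [Finset.sum_const, Finset.card_univ, Fintype.card_coe, nsmul_eq_mul]
          push_cast
          field_simp
  calc _ ≤ |∑ j, c j * K (x j) y - ∑ t : T, b t * K t y|
        + |∑ t : T, b t * K t y - gridExpansion K T R (m * T.card) k y| := abs_sub_le _ _ _
    _ ≤ R * (ω + κ / m) := by rw [mul_add]; exact add_le_add h2 h3

end Net

/-! ### Union bound over a finite family, and passage from the net -/

section Event

variable {X : Type*} [MeasurableSpace X] {ρ : Measure (X × ℝ)} [IsProbabilityMeasure ρ] {M : ℝ}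

/-- The excess losses of finitely many bounded functions are controlled by their sample means. -/
theorem exists_event_finite (hM : 0 < M) (hbounded : ∀ᵐ z ∂ρ, |z.2| ≤ M) {ι : Type*} [Fintype ι]
    {f : ι → X → ℝ} (hf : ∀ i, Measurable (f i)) {A : ℝ} (hA0 : 0 ≤ A)
    (hA : ∀ i x, |f i x| ≤ A)
    {f₀ : X → ℝ} (hf₀ : Measurable f₀) {A₀ : ℝ} (hA₀0 : 0 ≤ A₀) (hA₀ : ∀ x, |f₀ x| ≤ A₀)
    {m : ℕ} (hm : 1 ≤ m) {δ x : ℝ} (hx0 : 0 ≤ x)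
    (hx : (Fintype.card ι + 1) * Real.exp (-x) ≤ δ) :
    ∃ E : Set (Fin m → X × ℝ), MeasurableSet E ∧
      ENNReal.ofReal (1 - δ) ≤ (Measure.pi fun _ : Fin m => ρ) E ∧ ∀ z ∈ E,
        (∀ j, |(z j).2| ≤ M) ∧
        ((1 / (m : ℝ)) * ∑ j, excessLoss ρ f₀ (z j)
          ≤ 2 * ∫ z, excessLoss ρ f₀ z ∂ρ + 4 * (A₀ + 3 * M) ^ 2 * x / m) ∧
        ∀ i, ∫ z, excessLoss ρ (f i) z ∂ρ
          ≤ 2 * ((1 / (m : ℝ)) * ∑ j, excessLoss ρ (f i) (z j))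
            + 4 * (A + 3 * M) ^ 2 * x / m := by
  set Q := Measure.pi fun _ : Fin m => ρ
  let E₁ : Set (Fin m → X × ℝ) := {z | ∃ j, M < |(z j).2|}
  let E₂ : Set (Fin m → X × ℝ) :=
    {z | 2 * ∫ z, excessLoss ρ f₀ z ∂ρ + 4 * (A₀ + 3 * M) ^ 2 * x / m
      < (1 / (m : ℝ)) * ∑ j, excessLoss ρ f₀ (z j)}
  let E₃ : ι → Set (Fin m → X × ℝ) := fun i =>
    {z | 2 * ((1 / (m : ℝ)) * ∑ j, excessLoss ρ (f i) (z j)) + 4 * (A + 3 * M) ^ 2 * x / m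
      < ∫ z, excessLoss ρ (f i) z ∂ρ}
  have hm₀ := measurable_excessLoss (ρ := ρ) hf₀
  have hmi := fun i => measurable_excessLoss (ρ := ρ) (hf i)
  have hE₁ : Q E₁ = 0 := by
    have h1 : ∀ᵐ z ∂Q, ∀ j, |(z j).2| ≤ M := by
      rw [ae_all_iff]
      intro j
      exact (measurePreserving_eval (fun _ : Fin m => ρ) j).quasiMeasurePreserving.ae hbounded
    rw [ae_iff] at h1
    convert h1 using 2
    ext z
    simp [E₁]
  have hmE₁ : MeasurableSet E₁ := by
    have : E₁ = ⋃ j, {z | M < |(z j).2|} := by ext z; simp [E₁]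
    rw [this]
    exact MeasurableSet.iUnion fun j => measurableSet_lt (by fun_prop) (by fun_prop)
  have hmE₂ : MeasurableSet E₂ := measurableSet_lt (by fun_prop) (by fun_prop)
  have hmE₃ : ∀ i, MeasurableSet (E₃ i) := fun i => by
    have := hmi i
    exact measurableSet_lt (by fun_prop) (by fun_prop)
  have hE₂ : Q.real E₂ ≤ Real.exp (-x) :=
    measure_mean_gt_le hm₀ (by positivity)
      ((abs_excessLoss_le hbounded hA₀).mono fun z h => h.1)
      (integral_excessLoss_sq_le hbounded hf₀ hA₀) hm hx0
  have hE₃ : ∀ i, Q.real (E₃ i) ≤ Real.exp (-x) := fun i =>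
    measure_expectation_gt_le (hmi i) (by positivity)
      ((abs_excessLoss_le hbounded (hA i)).mono fun z h => h.1)
      (integral_excessLoss_sq_le hbounded (hf i) (hA i)) hm x
  set U := E₁ ∪ (E₂ ∪ ⋃ i, E₃ i) with hU
  have hmU : MeasurableSet U := hmE₁.union (hmE₂.union (MeasurableSet.iUnion hmE₃))
  have hUle : Q.real U ≤ δ := by
    calc Q.real U ≤ Q.real E₁ + (Q.real E₂ + Q.real (⋃ i, E₃ i)) :=
          (measureReal_union_le _ _).trans (add_le_add_right (measureReal_union_le _ _) _)
      _ ≤ 0 + (Real.exp (-x) + ∑ _i : ι, Real.exp (-x)) := by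
          refine add_le_add (by simp [measureReal_def, hE₁]) (add_le_add hE₂ ?_)
          exact (measureReal_iUnion_fintype_le _).trans (Finset.sum_le_sum fun i _ => hE₃ i)
      _ = (Fintype.card ι + 1) * Real.exp (-x) := by
          rw [Finset.sum_const, Finset.card_univ, nsmul_eq_mul]; ring
      _ ≤ δ := hx
  refine ⟨Uᶜ, hmU.compl, ?_, fun z hz => ?_⟩
  · rw [← ofReal_measureReal]
    refine ENNReal.ofReal_le_ofReal ?_
    rw [probReal_compl_eq_one_sub hmU]
    linarith
  · simp only [hU, Set.mem_compl_iff, Set.mem_union, Set.mem_iUnion, not_or, not_exists] at hz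
    obtain ⟨h1, h2, h3⟩ := hz
    refine ⟨fun j => ?_, not_lt.1 h2, fun i => not_lt.1 (h3 i)⟩
    by_contra hj
    exact h1 ⟨j, not_le.1 hj⟩

theorem abs_excessLoss_sub_le {f f' : X → ℝ} {A Δ : ℝ} (hA : ∀ x, |f x| ≤ A)
    (hA' : ∀ x, |f' x| ≤ A) (hΔ : ∀ x, |f x - f' x| ≤ Δ) {z : X × ℝ} (hz : |z.2| ≤ M) :
    |excessLoss ρ f z - excessLoss ρ f' z| ≤ Δ * (2 * A + 2 * M) := by
  have : excessLoss ρ f z - excessLoss ρ f' z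
      = (f z.1 - f' z.1) * (f z.1 + f' z.1 - 2 * z.2) := by
    unfold excessLoss; ring
  rw [this, abs_mul]
  have h1 := abs_le.1 (hA z.1)
  have h2 := abs_le.1 (hA' z.1)
  have h3 := abs_le.1 hz
  exact mul_le_mul (hΔ z.1) (abs_le.2 ⟨by linarith, by linarith⟩) (abs_nonneg _)
    ((abs_nonneg _).trans (hΔ z.1))

/-- Passing from a net to all functions close to it. -/
theorem integral_excessLoss_le_of_close (hbounded : ∀ᵐ z ∂ρ, |z.2| ≤ M) {f f' : X → ℝ}
    (hf : Measurable f) (hf' : Measurable f') {A Δ D : ℝ} (hA : ∀ x, |f x| ≤ A)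
    (hA' : ∀ x, |f' x| ≤ A) (hΔ : ∀ x, |f x - f' x| ≤ Δ) {m : ℕ} (hm : 1 ≤ m)
    {z : Fin m → X × ℝ} (hz : ∀ j, |(z j).2| ≤ M)
    (h : ∫ z, excessLoss ρ f' z ∂ρ
      ≤ 2 * ((1 / (m : ℝ)) * ∑ j, excessLoss ρ f' (z j)) + D) :
    ∫ z, excessLoss ρ f z ∂ρ ≤ 2 * ((1 / (m : ℝ)) * ∑ j, excessLoss ρ f (z j))
      + (3 * (Δ * (2 * A + 2 * M)) + D) := by
  have hm' : (0 : ℝ) < m := by exact_mod_cast hm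
  have hi : ∀ {f : X → ℝ}, Measurable f → (∀ x, |f x| ≤ A) → Integrable (excessLoss ρ f) ρ :=
    fun hf hA => Integrable.of_bound (measurable_excessLoss hf).aestronglyMeasurable _
      ((abs_excessLoss_le hbounded hA).mono fun z h => h.1)
  have h1 : ∫ z, excessLoss ρ f z ∂ρ
      ≤ ∫ z, excessLoss ρ f' z ∂ρ + Δ * (2 * A + 2 * M) := by
    have : ∫ z, (excessLoss ρ f' z + Δ * (2 * A + 2 * M)) ∂ρ
        = ∫ z, excessLoss ρ f' z ∂ρ + Δ * (2 * A + 2 * M) := by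
      rw [integral_add (hi hf' hA') (integrable_const _)]; simp
    rw [← this]
    refine integral_mono_ae (hi hf hA) ((hi hf' hA').add (integrable_const _)) ?_
    filter_upwards [hbounded] with z hz
    have := (abs_le.1 (abs_excessLoss_sub_le (ρ := ρ) hA hA' hΔ hz)).2
    linarith
  have h2 : (1 / (m : ℝ)) * ∑ j, excessLoss ρ f' (z j)
      ≤ (1 / (m : ℝ)) * ∑ j, excessLoss ρ f (z j) + Δ * (2 * A + 2 * M) := by
    have h3 : ∑ j, excessLoss ρ f' (z j)
        ≤ ∑ j, excessLoss ρ f (z j) + m * (Δ * (2 * A + 2 * M)) := by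
      calc ∑ j, excessLoss ρ f' (z j)
          ≤ ∑ j, (excessLoss ρ f (z j) + Δ * (2 * A + 2 * M)) :=
            Finset.sum_le_sum fun j _ => by
              have := (abs_le.1 (abs_excessLoss_sub_le (ρ := ρ) hA hA' hΔ (hz j))).1
              linarith
        _ = _ := by simp [Finset.sum_add_distrib]
    calc (1 / (m : ℝ)) * ∑ j, excessLoss ρ f' (z j)
        ≤ (1 / (m : ℝ)) * (∑ j, excessLoss ρ f (z j) + m * (Δ * (2 * A + 2 * M))) := by gcongr
      _ = _ := by field_simp
  linarith

end Event

/-! ### Covering numbers and the size of the net -/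

section Covering

variable {X : Type*} [MetricSpace X] [CompactSpace X]

theorem exists_finset_card_eq_coveringNumber {r : ℝ} (hr : 0 < r) :
    ∃ T : Finset X, T.card = coveringNumber X r ∧ ∀ x, ∃ t ∈ T, dist x t < r := by
  have hne : {n : ℕ | ∃ S : Finset X, S.card = n ∧
      (⋃ c ∈ S, Metric.ball c r) = Set.univ}.Nonempty := by
    obtain ⟨t, -, htf, ht⟩ := finite_cover_balls_of_compact (isCompact_univ (X := X)) hr
    refine ⟨_, htf.toFinset, rfl, ?_⟩
    simpa [Set.univ_subset_iff] using ht
  obtain ⟨T, hT, hT'⟩ := Nat.sInf_mem hne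
  refine ⟨T, hT, fun x => ?_⟩
  have : x ∈ ⋃ c ∈ T, Metric.ball c r := hT' ▸ Set.mem_univ x
  simpa using this

theorem log_net_le {N m : ℕ} (hN : 1 ≤ N) (hm : 1 ≤ m) {Cη θ δ : ℝ} (hCη : 0 < Cη)
    (hθ0 : 0 ≤ θ) (hθ1 : θ ≤ 1) (hNle : (N : ℝ) ≤ Cη * (m : ℝ) ^ (1 - θ)) (hδ0 : 0 < δ)
    (hδ1 : δ < 1) {n : ℕ} (hn : n ≤ (2 * (m * N) + 1) ^ N) :
    Real.log ((n + 1) / δ)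
      ≤ (Cη * (Real.log (2 * Cη + 1) + 2) + 1) * (m : ℝ) ^ (1 - θ)
        * Real.log ((2 + 2 * m) / δ) := by
  have hm1 : (1 : ℝ) ≤ m := by exact_mod_cast hm
  have hN1 : (1 : ℝ) ≤ N := by exact_mod_cast hN
  set L := Real.log ((2 + 2 * m) / δ) with hL
  have hmθ : (1 : ℝ) ≤ (m : ℝ) ^ (1 - θ) := Real.one_le_rpow hm1 (by linarith)
  have hmθ' : (m : ℝ) ^ (1 - θ) ≤ m := by
    calc (m : ℝ) ^ (1 - θ) ≤ (m : ℝ) ^ (1 : ℝ) :=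
          Real.rpow_le_rpow_of_exponent_le hm1 (by linarith)
      _ = m := Real.rpow_one _
  have hL2 : Real.log (2 / δ) ≤ L :=
    Real.log_le_log (by positivity) (by gcongr; linarith)
  have hLm : Real.log m ≤ L := by
    refine Real.log_le_log (by positivity) ?_
    rw [le_div_iff₀ hδ0]
    nlinarith
  have hL1 : 1 ≤ L := by
    rw [hL, Real.le_log_iff_exp_le (by positivity), le_div_iff₀ hδ0]
    have := Real.exp_one_lt_d9
    nlinarith [Real.exp_pos 1]
  have h1 : Real.log ((n + 1) / δ) ≤ N * Real.log (2 * (m * N) + 1) + Real.log (2 / δ) := by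
    have hn' : (n : ℝ) ≤ (2 * (m * N) + 1) ^ N := by exact_mod_cast hn
    have h2 : (1 : ℝ) ≤ (2 * (m * N) + 1) ^ N := one_le_pow₀ (by nlinarith)
    rw [← Real.log_pow, ← Real.log_mul (by positivity) (by positivity)]
    refine Real.log_le_log (by positivity) ?_
    rw [← mul_div_assoc]
    gcongr
    linarith
  have h2 : Real.log (2 * (m * N) + 1) ≤ (Real.log (2 * Cη + 1) + 2) * L := by
    have h3 : 2 * (m * N) + 1 ≤ (2 * Cη + 1) * (m : ℝ) ^ 2 := by
      have : (N : ℝ) ≤ Cη * m := hNle.trans (mul_le_mul_of_nonneg_left hmθ' hCη.le)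
      nlinarith
    calc Real.log (2 * (m * N) + 1) ≤ Real.log ((2 * Cη + 1) * (m : ℝ) ^ 2) :=
          Real.log_le_log (by positivity) h3
      _ = Real.log (2 * Cη + 1) + 2 * Real.log m := by
          rw [Real.log_mul (by positivity) (by positivity), Real.log_pow]; norm_num
      _ ≤ _ := by
          have : 0 ≤ Real.log (2 * Cη + 1) := Real.log_nonneg (by linarith)
          nlinarith
  have h0 : 0 ≤ Real.log (2 * Cη + 1) := Real.log_nonneg (by linarith)
  calc Real.log ((n + 1) / δ)
      ≤ N * Real.log (2 * (m * N) + 1) + Real.log (2 / δ) := h1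
    _ ≤ (Cη * (m : ℝ) ^ (1 - θ)) * ((Real.log (2 * Cη + 1) + 2) * L)
        + (m : ℝ) ^ (1 - θ) * L := by
        refine add_le_add ?_ ?_
        · exact mul_le_mul hNle h2 (Real.log_nonneg (by nlinarith)) (by positivity)
        · nlinarith
    _ = _ := by ring

theorem abs_kernelExpansion_le (K : C(X × X, ℝ)) {m : ℕ} (z : Fin m → X × ℝ) {c : Fin m → ℝ}
    {R : ℝ} (hc : ∑ j, |c j| ≤ R) (x : X) :
    |kernelExpansion (fun x t => K (x, t)) z c x| ≤ R * ‖K‖ := by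
  refine (Finset.abs_sum_le_sum_abs _ _).trans ?_
  calc ∑ j, |c j * K ((z j).1, x)| ≤ ∑ j, |c j| * ‖K‖ := Finset.sum_le_sum fun j _ => by
        rw [abs_mul]
        exact mul_le_mul_of_nonneg_left (K.norm_coe_le_norm _) (abs_nonneg _)
    _ = (∑ j, |c j|) * ‖K‖ := by rw [Finset.sum_mul]
    _ ≤ R * ‖K‖ := mul_le_mul_of_nonneg_right hc (norm_nonneg _)

theorem continuous_kernelExpansion {X : Type*} [TopologicalSpace X] (K : C(X × X, ℝ)) {m : ℕ} (z : Fin m → X × ℝ)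
    (c : Fin m → ℝ) : Continuous (kernelExpansion (fun x t => K (x, t)) z c) := by
  change Continuous fun x => ∑ j, c j * K ((z j).1, x)
  fun_prop

end Covering

/-! ### Uniform deviation bound over the ℓ¹ ball -/

section Uniform

variable {X : Type*} [MetricSpace X] [CompactSpace X] [MeasurableSpace X] [BorelSpace X]
  {ρ : Measure (X × ℝ)} [IsProbabilityMeasure ρ] {M : ℝ}

set_option maxHeartbeats 1000000 in
theorem exists_uniform_event (hM : 0 < M) (hbounded : ∀ᵐ z ∂ρ, |z.2| ≤ M)
    {η Cη : ℝ} (hη : 0 < η) (hCη : 0 < Cη)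
    (hcover : ∀ r : ℝ, 0 < r → r ≤ 1 → (coveringNumber X r : ℝ) ≤ Cη / r ^ η)
    {K : C(X × X, ℝ)} (hpos : IsPosDefKernel fun x t => K (x, t))
    {α Cα : ℝ} (hα : 0 < α) (hCα : 0 < Cα)
    (hlip : ∀ x t t' : X, |K (x, t) - K (x, t')| ≤ Cα * dist t t' ^ α)
    {A₁ : ℝ} (hA₁ : 0 ≤ A₁) :
    ∃ C : ℝ, 0 < C ∧ ∀ m : ℕ, 1 ≤ m → ∀ lam : ℝ, 0 < lam → lam ≤ 1 →
      ∀ δ : ℝ, 0 < δ → δ < 1 → ∀ f₀ : X → ℝ, Measurable f₀ → (∀ x, |f₀ x| ≤ A₁ / lam) →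
      ∃ E : Set (Fin m → X × ℝ), MeasurableSet E ∧
        ENNReal.ofReal (1 - δ) ≤ (Measure.pi fun _ : Fin m => ρ) E ∧ ∀ z ∈ E,
        (∀ j, |(z j).2| ≤ M) ∧
        ((1 / (m : ℝ)) * ∑ j, excessLoss ρ f₀ (z j) ≤ 2 * ∫ z, excessLoss ρ f₀ z ∂ρ
          + C * ((m : ℝ) ^ (-(1 / (1 + η / α))) * Real.log ((2 + 2 * m) / δ) / lam ^ 2)) ∧
        ∀ c : Fin m → ℝ, ∑ j, |c j| ≤ M ^ 2 / lam →
          ∫ w, excessLoss ρ (kernelExpansion (fun x t => K (x, t)) z c) w ∂ρ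
            ≤ 2 * ((1 / (m : ℝ)) *
                ∑ j, excessLoss ρ (kernelExpansion (fun x t => K (x, t)) z c) (z j))
              + C * ((m : ℝ) ^ (-(1 / (1 + η / α)))
                * Real.log ((2 + 2 * m) / δ) / lam ^ 2) := by
  classical
  set θ := 1 / (1 + η / α) with hθ
  have hηα : 0 < η / α := div_pos hη hα
  have hθ0 : 0 < θ := by positivity
  have hθ1 : θ ≤ 1 := by
    rw [hθ, div_le_one (by positivity)]; linarith
  -- This defines θ: at radius m^(−θ/α) the kernel varies by order m^(−θ), and the covering number,
  -- of order m^(1−θ), divided by m has the same order.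
  have hθη : θ / α * η = 1 - θ := by
    rw [hθ]; field_simp; ring
  set κ := ‖K‖ with hκ
  have hκ0 : 0 ≤ κ := norm_nonneg _
  -- The summand 3/M lets 3M be absorbed in R·C₁, since λ ≤ 1 gives M ≤ R/M.
  set C₁ := 2 * κ + Cα + 3 / M with hC₁
  have hC₁0 : 0 < C₁ := by positivity
  set C₂ := Cη * (Real.log (2 * Cη + 1) + 2) + 1 with hC₂
  have hC₂0 : 0 < C₂ := by
    have : 0 ≤ Real.log (2 * Cη + 1) := Real.log_nonneg (by linarith)
    positivity
  refine ⟨M ^ 4 * C₁ ^ 2 * (6 + 4 * C₂) + 4 * (A₁ + 3 * M) ^ 2 * C₂, by positivity, ?_⟩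
  intro m hm lam hlam hlam1 δ hδ0 hδ1 f₀ hf₀ hA₀
  have hm1 : (1 : ℝ) ≤ m := by exact_mod_cast hm
  have hm0 : (0 : ℝ) < m := by linarith
  set L := Real.log ((2 + 2 * m) / δ) with hL
  have hL1 : 1 ≤ L := by
    rw [hL, Real.le_log_iff_exp_le (by positivity), le_div_iff₀ hδ0]
    have := Real.exp_one_lt_d9
    nlinarith [Real.exp_pos 1]
  set μ := (m : ℝ) ^ (-θ) with hμ
  have hμ0 : 0 < μ := by positivity
  have hμm : 1 / (m : ℝ) ≤ μ := by
    rw [hμ, one_div, ← Real.rpow_neg_one]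
    exact Real.rpow_le_rpow_of_exponent_le hm1 (by linarith)
  set r := (m : ℝ) ^ (-(θ / α)) with hr
  have hr0 : 0 < r := by positivity
  have hr1 : r ≤ 1 := Real.rpow_le_one_of_one_le_of_nonpos hm1 (by
    have : 0 < θ / α := by positivity
    linarith)
  have hrα : r ^ α = μ := by
    rw [hr, ← Real.rpow_mul hm0.le, hμ]; congr 1; field_simp
  obtain ⟨T, hTc, hT⟩ := exists_finset_card_eq_coveringNumber (X := X) hr0
  have hXne : Nonempty X := by
    have : Nonempty (X × ℝ) := ρ.nonempty_of_neZero
    exact this.map Prod.fst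
  have hTne : T.Nonempty := by
    obtain ⟨x⟩ := hXne
    obtain ⟨t, ht, -⟩ := hT x
    exact ⟨t, ht⟩
  have hTcard : (T.card : ℝ) ≤ Cη * (m : ℝ) ^ (1 - θ) := by
    rw [hTc]
    refine (hcover r hr0 hr1).trans_eq ?_
    rw [hr, ← Real.rpow_mul hm0.le, neg_mul, hθη, Real.rpow_neg hm0.le, div_inv_eq_mul]
  set R := M ^ 2 / lam with hR
  have hR0 : 0 < R := by positivity
  have hMR : M ≤ R / M := by
    rw [hR, le_div_iff₀ hM, ← pow_two, le_div_iff₀ hlam]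
    nlinarith [sq_nonneg M]
  set A := R * (2 * κ + Cα) with hA
  have hA0 : 0 ≤ A := by positivity
  have hA3M : A + 3 * M ≤ R * C₁ := by
    have : R * (3 / M) = 3 * (R / M) := by ring
    rw [hA, hC₁, mul_add R (2 * κ + Cα), this]
    linarith
  set Δ := R * ((Cα + κ) * μ) with hΔ
  have hμ1 : μ ≤ 1 := Real.rpow_le_one_of_one_le_of_nonpos hm1 (by linarith)
  have hΔA : R * κ + Δ ≤ A := by
    rw [hA, hΔ, ← mul_add]
    refine mul_le_mul_of_nonneg_left ?_ hR0.le
    nlinarith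
  let g := gridExpansion (fun x t => K (x, t)) T R (m * T.card)
  -- Arbitrary grid coefficients may each be of size R, so their expansion may be of order |T|R.
  -- Only those bounded by A are kept; they include every one needed, by `hΔA`.
  let ι := {k : T → Fin (2 * (m * T.card) + 1) // ∀ x, |g k x| ≤ A}
  have hgm : ∀ k, Measurable (g k) := by
    intro k
    have : Continuous (g k) := by
      change Continuous fun x => ∑ t : T, _ * _ * K (t, x)
      fun_prop
    exact this.measurable
  have hcard : Fintype.card ι ≤ (2 * (m * T.card) + 1) ^ T.card := by
    refine (Fintype.card_subtype_le _).trans_eq ?_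
    rw [Fintype.card_fun, Fintype.card_fin, Fintype.card_coe]
  set x := Real.log ((Fintype.card ι + 1) / δ) with hx
  have hx0 : 0 ≤ x := by
    refine Real.log_nonneg ?_
    rw [le_div_iff₀ hδ0]
    have : (0 : ℝ) ≤ Fintype.card ι := Nat.cast_nonneg _
    linarith
  have hxle : x ≤ C₂ * (m : ℝ) ^ (1 - θ) * L :=
    log_net_le hTne.card_pos hm hCη hθ0.le hθ1 hTcard hδ0 hδ1 hcard
  have hxm : x / m ≤ C₂ * (μ * L) := by
    rw [div_le_iff₀ hm0]
    refine hxle.trans_eq ?_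
    have : (m : ℝ) ^ (1 - θ) = μ * m := by
      rw [hμ, ← Real.rpow_add_one hm0.ne']; congr 1; ring
    rw [this]; ring
  have hexp : (Fintype.card ι + 1) * Real.exp (-x) ≤ δ := by
    rw [Real.exp_neg, hx, Real.exp_log (by positivity)]
    apply le_of_eq
    field_simp
  obtain ⟨E, hE, hEP, hEz⟩ := exists_event_finite hM hbounded (f := fun i : ι => g i.1)
    (fun i => hgm i.1) hA0 (fun i => i.2) hf₀ (by positivity) hA₀ hm hx0 hexp
  refine ⟨E, hE, hEP, fun z hz => ?_⟩
  obtain ⟨h1, h2, h3⟩ := hEz z hz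
  have hμL : μ ≤ μ * L := le_mul_of_one_le_right hμ0.le hL1
  have hμL0 : 0 ≤ μ * L := hμ0.le.trans hμL
  refine ⟨h1, h2.trans ?_, fun c hc => ?_⟩
  · rw [add_le_add_iff_left]
    have e1 : A₁ / lam + 3 * M ≤ (A₁ + 3 * M) / lam := by
      rw [add_div]
      gcongr
      rw [le_div_iff₀ hlam]; nlinarith
    calc 4 * (A₁ / lam + 3 * M) ^ 2 * x / m = 4 * (A₁ / lam + 3 * M) ^ 2 * (x / m) := by ring
      _ ≤ 4 * ((A₁ + 3 * M) / lam) ^ 2 * (C₂ * (μ * L)) := by gcongr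
      _ = 4 * (A₁ + 3 * M) ^ 2 * C₂ * (μ * L / lam ^ 2) := by ring
      _ ≤ _ := by
        refine mul_le_mul_of_nonneg_right ?_ (by positivity)
        have : 0 ≤ M ^ 4 * C₁ ^ 2 * (6 + 4 * C₂) := by positivity
        linarith
  · have hnet : ∀ x, ∃ t ∈ T, ∀ y, |K (x, y) - K (t, y)| ≤ Cα * μ := by
      intro x
      obtain ⟨t, ht, hxt⟩ := hT x
      refine ⟨t, ht, fun y => ?_⟩
      have e1 : K (x, y) = K (y, x) := hpos.symm x y
      have e2 : K (t, y) = K (y, t) := hpos.symm t y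
      rw [e1, e2]
      refine (hlip y x t).trans ?_
      rw [← hrα]
      gcongr
    obtain ⟨k, hk⟩ := exists_gridExpansion_approx (K := fun x t => K (x, t)) hTne
      (by positivity) hnet (fun x y => K.norm_coe_le_norm (x, y)) hR0 hm (fun j => (z j).1) hc
    have hfA : ∀ x, |kernelExpansion (fun x t => K (x, t)) z c x| ≤ R * κ :=
      abs_kernelExpansion_le K z hc
    have hclose : ∀ x, |kernelExpansion (fun x t => K (x, t)) z c x - g k x| ≤ Δ := by
      intro x
      refine (hk x).trans ?_
      rw [hΔ]
      refine mul_le_mul_of_nonneg_left ?_ hR0.le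
      have : κ / m = κ * (1 / m) := by ring
      rw [add_mul, this]
      gcongr
    have hgA : ∀ x, |g k x| ≤ A := by
      intro x
      have e1 := abs_sub_abs_le_abs_sub (g k x) (kernelExpansion (fun x t => K (x, t)) z c x)
      rw [abs_sub_comm] at e1
      linarith [hclose x, hfA x]
    have hΔ0 : 0 ≤ Δ := by positivity
    have h4 := integral_excessLoss_le_of_close hbounded
      (continuous_kernelExpansion K z c).measurable (hgm k)
      (fun x => (hfA x).trans (by linarith)) hgA hclose hm h1 (h3 ⟨k, hgA⟩)
    refine h4.trans ?_
    rw [add_le_add_iff_left]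
    have e1 : Δ ≤ R * C₁ * (μ * L) := by
      rw [hΔ, mul_assoc R]
      refine mul_le_mul_of_nonneg_left ?_ hR0.le
      refine mul_le_mul ?_ hμL hμ0.le hC₁0.le
      have : 0 < 3 / M := by positivity
      linarith
    have e2 : 2 * A + 2 * M ≤ 2 * (R * C₁) := by linarith
    calc 3 * (Δ * (2 * A + 2 * M)) + 4 * (A + 3 * M) ^ 2 * x / m
        = 3 * (Δ * (2 * A + 2 * M)) + 4 * (A + 3 * M) ^ 2 * (x / m) := by ring
      _ ≤ 3 * ((R * C₁ * (μ * L)) * (2 * (R * C₁))) + 4 * (R * C₁) ^ 2 * (C₂ * (μ * L)) := by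
          gcongr
      _ = M ^ 4 * C₁ ^ 2 * (6 + 4 * C₂) * (μ * L / lam ^ 2) := by
          rw [hR]; field_simp; ring
      _ ≤ _ := by
        refine mul_le_mul_of_nonneg_right ?_ (by positivity)
        have : 0 ≤ 4 * (A₁ + 3 * M) ^ 2 * C₂ := by positivity
        linarith

end Uniform

/-! ### Deterministic error bounds and duality -/

theorem exists_sign {X : Type*} [MeasurableSpace X] {ρ : Measure (X × ℝ)} [IsProbabilityMeasure ρ]
    (g : Lp ℝ 2 ρ.fst) :
    ∃ v : Lp ℝ 2 ρ.fst, (∀ᵐ x ∂ρ.fst, |v x| ≤ 1) ∧ ‖v‖ ≤ 1 ∧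
      ∫ x, |g x| ∂ρ.fst = inner ℝ v g := by
  have hm : Measurable fun x => if 0 ≤ g x then (1 : ℝ) else -1 :=
    Measurable.ite (measurableSet_le measurable_const (Lp.stronglyMeasurable g).measurable)
      measurable_const measurable_const
  have hb : ∀ x, ‖if 0 ≤ g x then (1 : ℝ) else -1‖ ≤ 1 := fun x => by split_ifs <;> simp
  have hL : MemLp (fun x => if 0 ≤ g x then (1 : ℝ) else -1) 2 ρ.fst :=
    MemLp.of_bound hm.aestronglyMeasurable 1 (Filter.Eventually.of_forall hb)
  have hv := hL.coeFn_toLp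
  have hv1 : ∀ᵐ x ∂ρ.fst, ‖hL.toLp _ x‖ ≤ 1 := by
    filter_upwards [hv] with x hx
    rw [hx]; exact hb x
  refine ⟨hL.toLp _, hv1, ?_, ?_⟩
  · have := Lp.norm_le_of_ae_bound zero_le_one hv1
    have hμ : measureUnivNNReal ρ.fst = 1 := by simp [measureUnivNNReal]
    simpa [hμ] using this
  · rw [L2.inner_def]
    refine integral_congr_ae ?_
    filter_upwards [hv] with x hx
    rw [hx]
    split_ifs with h
    · simp [abs_of_nonneg h]
    · simp [abs_of_neg (not_le.1 h)]

section Deterministic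

variable {X : Type*} [MetricSpace X] [CompactSpace X] [MeasurableSpace X] [BorelSpace X]
  {ρ : Measure (X × ℝ)} [IsProbabilityMeasure ρ] {M : ℝ} {K : C(X × X, ℝ)}

theorem integral_sq_sub_eq_norm_sq (f : C(X, ℝ)) {g : Lp ℝ 2 ρ.fst}
    (hg : g =ᵐ[ρ.fst] regressionFunction ρ) :
    ∫ x, (f x - regressionFunction ρ x) ^ 2 ∂ρ.fst
      = ‖ContinuousMap.toLp 2 ρ.fst ℝ f - g‖ ^ 2 := by
  rw [← real_inner_self_eq_norm_sq, L2.inner_def]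
  refine integral_congr_ae ?_
  filter_upwards [ContinuousMap.coeFn_toLp (p := 2) (𝕜 := ℝ) ρ.fst f, hg,
    Lp.coeFn_sub (ContinuousMap.toLp 2 ρ.fst ℝ f) g] with x h1 h2 h3
  rw [h3, Pi.sub_apply, h1, h2]
  simp [pow_two]

/-- The error of a minimizer in terms of the approximation by `∫ K(t, ·) p(t)`. -/
theorem integral_excessLoss_minimizer_le (hpos : IsPosDefKernel fun x t => K (x, t))
    (hH2 : ConditionH2 fun x t => K (x, t)) (p : Lp ℝ 2 ρ.fst) {m : ℕ} {z : Fin m → X × ℝ}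
    {lam Δ : ℝ} (hlam : 0 ≤ lam) {c : Fin m → ℝ}
    (hc : IsL1Minimizer (fun x t => K (x, t)) z lam c)
    (h₀ : (1 / (m : ℝ)) * ∑ j, excessLoss ρ (integralTransform ρ.fst K p) (z j)
      ≤ 2 * ∫ z, excessLoss ρ (integralTransform ρ.fst K p) z ∂ρ + Δ)
    (h : ∫ w, excessLoss ρ (kernelExpansion (fun x t => K (x, t)) z c) w ∂ρ
      ≤ 2 * ((1 / (m : ℝ)) *
        ∑ j, excessLoss ρ (kernelExpansion (fun x t => K (x, t)) z c) (z j)) + Δ) :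
    ∫ w, excessLoss ρ (kernelExpansion (fun x t => K (x, t)) z c) w ∂ρ
      ≤ 4 * ∫ z, excessLoss ρ (integralTransform ρ.fst K p) z ∂ρ
        + 2 * lam * (∫ t, |p t| ∂ρ.fst - ∑ j, |c j|) + 3 * Δ := by
  -- The empirical loss of f_ρ cancels between the two sides, so the objective inequality compares
  -- empirical excess losses. The two deviation bounds contribute Δ and 2Δ.
  have h1 := hc.objective_le ρ.fst hpos hH2 p hlam
  unfold l1Objective at h1
  have h2 : ∀ f : X → ℝ, (1 / (m : ℝ)) * ∑ j, excessLoss ρ f (z j)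
      = (1 / (m : ℝ)) * ∑ j, (f (z j).1 - (z j).2) ^ 2
        - (1 / (m : ℝ)) * ∑ j, (regressionFunction ρ (z j).1 - (z j).2) ^ 2 := by
    intro f
    unfold excessLoss
    rw [Finset.sum_sub_distrib, mul_sub]
  rw [h2] at h₀ h
  linarith

theorem inner_toLp_kernelExpansion (hpos : IsPosDefKernel fun x t => K (x, t))
    (q : Lp ℝ 2 ρ.fst) {m : ℕ} (z : Fin m → X × ℝ) (c : Fin m → ℝ) {f : C(X, ℝ)}
    (hf : ∀ x, f x = kernelExpansion (fun x t => K (x, t)) z c x) :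
    inner ℝ q (ContinuousMap.toLp 2 ρ.fst ℝ f)
      = ∑ j, c j * integralTransform ρ.fst K q (z j).1 := by
  have hq := integrable_of_Lp ρ.fst q
  have h1 : ∀ j, c j * integralTransform ρ.fst K q (z j).1
      = ∫ t, c j * (K (t, (z j).1) * q t) ∂ρ.fst := fun j => (integral_const_mul _ _).symm
  simp_rw [h1]
  rw [← integral_finsetSum _ fun j _ => (integrable_kernel_mul ρ.fst K q hq _).const_mul _,
    L2.inner_def]
  refine integral_congr_ae ?_
  filter_upwards [ContinuousMap.coeFn_toLp (p := 2) (𝕜 := ℝ) ρ.fst f] with x hx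
  rw [hx, hf]
  simp only [kernelExpansion, RCLike.inner_apply, conj_trivial, Finset.sum_mul]
  refine Finset.sum_congr rfl fun j _ => ?_
  have : K (x, (z j).1) = K ((z j).1, x) := hpos.symm x (z j).1
  rw [this]; ring

/-- A lower bound for the `ℓ¹` norm of the coefficients of a kernel expansion close to
`L_K g₀`. -/
theorem integral_abs_sub_sum_abs_le (hpos : IsPosDefKernel fun x t => K (x, t))
    (hH2 : ConditionH2 fun x t => K (x, t)) {g₀ w : Lp ℝ 2 ρ.fst} {ε : ℝ} (hε : 0 < ε)
    (hw : integralOperator ρ.fst K w + ε • w = g₀) {m : ℕ} (z : Fin m → X × ℝ)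
    (c : Fin m → ℝ) {f : C(X, ℝ)}
    (hf : ∀ x, f x = kernelExpansion (fun x t => K (x, t)) z c x) :
    ∫ t, |g₀ t| ∂ρ.fst - ∑ j, |c j| ≤ ε * ‖w‖
      + ε⁻¹ * ‖ContinuousMap.toLp 2 ρ.fst ℝ f - integralOperator ρ.fst K g₀‖ := by
  set T := integralOperator ρ.fst K with hT
  have hsym : ∀ f g, inner ℝ (T f) g = inner ℝ f (T g) := integralOperator_symm ρ.fst hpos
  obtain ⟨R, hR1, -, hR3⟩ := exists_resolvent (integralOperator_nonneg ρ.fst hpos) hε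
  obtain ⟨v₀, hv₀, hv₀n, hv₀g⟩ := exists_sign g₀
  set q := R v₀ with hq
  have hqe : T q + ε • q = v₀ := hR1 v₀
  have hqn : ‖q‖ ≤ ε⁻¹ := (hR3 v₀).trans (mul_le_of_le_one_right (by positivity) hv₀n)
  have hmax : ∀ x, |integralTransform ρ.fst K q x| ≤ 1 := by
    refine abs_integralTransform_le_one ρ.fst hpos hH2 q hv₀ hε ?_
    have e1 := Lp.coeFn_add (T q) (ε • q)
    rw [hqe] at e1
    filter_upwards [e1, Lp.coeFn_smul ε q, integralOperator_ae_eq ρ.fst K q] with x h1 h2 h3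
    rw [h1, Pi.add_apply, h2, h3]
    simp only [Pi.smul_apply, smul_eq_mul, integralTransform, ContinuousMap.coe_mk]
    ring
  -- q is dual feasible: pairing with the expansion evaluates Tq at the nodes, where it is at most 1
  -- in absolute value.
  have h1 : inner ℝ q (ContinuousMap.toLp 2 ρ.fst ℝ f) ≤ ∑ j, |c j| := by
    rw [inner_toLp_kernelExpansion hpos q z c hf]
    refine Finset.sum_le_sum fun j _ => (le_abs_self _).trans ?_
    rw [abs_mul]
    exact mul_le_of_le_one_right (abs_nonneg _) (hmax _)
  set u := ContinuousMap.toLp 2 ρ.fst ℝ f - T g₀ with hu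
  have h2 : -(ε⁻¹ * ‖u‖) ≤ inner ℝ q u :=
    (neg_le_neg (mul_le_mul_of_nonneg_right hqn (norm_nonneg u))).trans
      (neg_le_of_abs_le (abs_real_inner_le_norm q u))
  rw [hu, inner_sub_right, ← hsym, ← hu] at h2
  -- Since the resolvent is symmetric, it is moved from the sign function v₀ to g₀, where the source
  -- condition bounds it.
  have h3 : inner ℝ v₀ g₀ - inner ℝ (T q) g₀ = ε * inner ℝ v₀ w := by
    have e1 : inner ℝ v₀ g₀ - inner ℝ (T q) g₀ = ε * inner ℝ q g₀ := by
      rw [← inner_sub_left, ← hqe, add_sub_cancel_left, inner_smul_left]; rfl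
    rw [e1, ← hw, ← hqe, inner_add_right, inner_add_left, inner_smul_right, inner_smul_left,
      hsym]
    rfl
  have h4 : inner ℝ v₀ w ≤ ‖w‖ :=
    (real_inner_le_norm _ _).trans (mul_le_of_le_one_left (norm_nonneg _) hv₀n)
  rw [hv₀g]
  nlinarith

end Deterministic

/-! ### Choice of parameters and rates -/

section Rates

variable {X : Type*} [MetricSpace X] [CompactSpace X] [MeasurableSpace X] [BorelSpace X]
  {ρ : Measure (X × ℝ)} [IsProbabilityMeasure ρ] {M : ℝ} {K : C(X × X, ℝ)}

theorem integral_excessLoss_integralTransform (hbounded : ∀ᵐ z ∂ρ, |z.2| ≤ M)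
    (p : Lp ℝ 2 ρ.fst) {g : Lp ℝ 2 ρ.fst} (hg : g =ᵐ[ρ.fst] regressionFunction ρ) :
    ∫ z, excessLoss ρ (integralTransform ρ.fst K p) z ∂ρ
      = ‖integralOperator ρ.fst K p - g‖ ^ 2 := by
  rw [integral_excessLoss hbounded (integralTransform ρ.fst K p).continuous.measurable
    (fun x => abs_integralTransform_le ρ.fst K p x)]
  exact integral_sq_sub_eq_norm_sq (integralTransform ρ.fst K p) hg

theorem abs_integralTransform_le_norm (p : Lp ℝ 2 ρ.fst) (x : X) :
    |integralTransform ρ.fst K p x| ≤ ‖K‖ * ‖p‖ :=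
  (abs_integralTransform_le ρ.fst K p x).trans
    (mul_le_mul_of_nonneg_left (integral_abs_le_norm p) (norm_nonneg _))

theorem one_le_log_ratio (m : ℕ) (hm : 1 ≤ m) {δ : ℝ} (hδ0 : 0 < δ) (hδ1 : δ < 1) :
    1 ≤ Real.log ((2 + 2 * m) / δ) := by
  have hm1 : (1 : ℝ) ≤ m := by exact_mod_cast hm
  rw [Real.le_log_iff_exp_le (by positivity), le_div_iff₀ hδ0]
  have := Real.exp_one_lt_d9
  nlinarith [Real.exp_pos 1]

theorem rate_of_lt_one (hM : 0 < M) (hbounded : ∀ᵐ z ∂ρ, |z.2| ≤ M)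
    {η Cη : ℝ} (hη : 0 < η) (hCη : 0 < Cη)
    (hcover : ∀ r : ℝ, 0 < r → r ≤ 1 → (coveringNumber X r : ℝ) ≤ Cη / r ^ η)
    (hpos : IsPosDefKernel fun x t => K (x, t)) (hH2 : ConditionH2 fun x t => K (x, t))
    {α Cα : ℝ} (hα : 0 < α) (hCα : 0 < Cα)
    (hlip : ∀ x t t' : X, |K (x, t) - K (x, t')| ≤ Cα * dist t t' ^ α)
    {s : ℝ} (hs : 0 < s) (hs1 : s < 1) {g : Lp ℝ 2 ρ.fst}
    (hgs : g ∈ rangeOfPower (integralOperator ρ.fst K) s)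
    (hg : g =ᵐ[ρ.fst] regressionFunction ρ) :
    ∃ C : ℝ, 0 < C ∧ ∀ m : ℕ, 1 ≤ m → ∀ lam : ℝ,
      lam = (m : ℝ) ^ (-((1 / 2) * (1 / (1 + η / α)) * ((1 + s) / (1 + 2 * s)))) →
      ∀ δ : ℝ, 0 < δ → δ < 1 →
        HoldsWithConfidence (Measure.pi fun _ : Fin m => ρ) δ fun z =>
          ∀ c : Fin m → ℝ, IsL1Minimizer (fun x t => K (x, t)) z lam c →
            generalizationError ρ (kernelExpansion (fun x t => K (x, t)) z c)
                - generalizationError ρ (regressionFunction ρ)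
              ≤ C * (m : ℝ) ^ (-((s / (1 + 2 * s)) * (1 / (1 + η / α))))
                  * Real.log ((2 + 2 * m) / δ) := by
  obtain ⟨h, hh⟩ := hgs
  obtain ⟨C, hC, hE⟩ := exists_uniform_event hM hbounded hη hCη hcover hpos hα hCα hlip
    (A₁ := ‖K‖ * ‖h‖) (by positivity)
  refine ⟨4 * ‖h‖ ^ 2 + 2 * ‖h‖ + 3 * C, by positivity, ?_⟩
  intro m hm lam hlam δ hδ0 hδ1
  have hηα : 0 < η / α := div_pos hη hα
  set θ := 1 / (1 + η / α) with hθ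
  have hθ0 : 0 < θ := by positivity
  have hm1 : (1 : ℝ) ≤ m := by exact_mod_cast hm
  have hm0 : (0 : ℝ) < m := by linarith
  set L := Real.log ((2 + 2 * m) / δ) with hL
  have hL1 : 1 ≤ L := one_le_log_ratio m hm hδ0 hδ1
  set B := (m : ℝ) ^ (-((s / (1 + 2 * s)) * θ)) with hB
  have hB0 : 0 < B := by positivity
  have hB1 : B ≤ 1 := Real.rpow_le_one_of_one_le_of_nonpos hm1 (by
    have : 0 < s / (1 + 2 * s) * θ := by positivity
    linarith)
  have hlam0 : 0 < lam := by rw [hlam]; positivity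
  have hlam1 : lam ≤ 1 := by
    rw [hlam]
    refine Real.rpow_le_one_of_one_le_of_nonpos hm1 ?_
    have : 0 < 1 / 2 * θ * ((1 + s) / (1 + 2 * s)) := by positivity
    linarith
  -- This ε equalizes the approximation term ε^(2s) and the penalty λε^(s−1); for the given λ both
  -- equal the statistical factor m^(−θ)/λ², namely B.
  set ε := (m : ℝ) ^ (-(θ / (2 * (1 + 2 * s)))) with hε
  have hε0 : 0 < ε := by positivity
  set τ := ε ^ (s - 1) with hτ
  have hτ0 : 0 < τ := by positivity
  have hετ : (ε * τ) ^ 2 = B := by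
    rw [hτ, mul_comm, ← Real.rpow_add_one hε0.ne', hε, ← Real.rpow_mul hm0.le,
      ← Real.rpow_mul_natCast hm0.le, hB]
    congr 1; push_cast; field_simp; ring
  have hlamτ : lam * τ = B := by
    rw [hτ, hlam, hε, ← Real.rpow_mul hm0.le, ← Real.rpow_add hm0, hB]
    congr 1; field_simp; ring
  have hΔ : (m : ℝ) ^ (-θ) * L / lam ^ 2 = B * L := by
    have : (m : ℝ) ^ (-θ) = B * lam ^ 2 := by
      rw [hlam, ← Real.rpow_mul_natCast hm0.le, hB, ← Real.rpow_add hm0]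
      congr 1; push_cast; field_simp; ring
    rw [this]; field_simp
  set T := integralOperator ρ.fst K with hT
  have hsym : ∀ f g, inner ℝ (T f) g = inner ℝ f (T g) := integralOperator_symm ρ.fst hpos
  have hnn := integralOperator_nonneg ρ.fst hpos
  obtain ⟨R, hR, -, -⟩ := exists_resolvent hnn hε0
  set p := R g with hp
  have hpg : T p + ε • p = g := hR g
  have hpn : ‖p‖ ≤ τ * ‖h‖ := by
    have := norm_resolvent_le hsym hnn hs.le hs1.le le_rfl hε0 hh hpg
    simpa using this
  have hf₀ : ∀ x, |integralTransform ρ.fst K p x| ≤ ‖K‖ * ‖h‖ / lam := by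
    intro x
    refine (abs_integralTransform_le_norm p x).trans ?_
    rw [mul_div_assoc]
    refine mul_le_mul_of_nonneg_left (hpn.trans ?_) (norm_nonneg _)
    rw [le_div_iff₀ hlam0]
    calc τ * ‖h‖ * lam = B * ‖h‖ := by rw [← hlamτ]; ring
      _ ≤ ‖h‖ := mul_le_of_le_one_left (norm_nonneg _) hB1
  obtain ⟨E, hEm, hEP, hEz⟩ := hE m hm lam hlam0 hlam1 δ hδ0 hδ1 _
    (integralTransform ρ.fst K p).continuous.measurable hf₀
  refine ⟨E, hEm, hEP, fun z hz c hc => ?_⟩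
  obtain ⟨h1, h2, h3⟩ := hEz z hz
  have hcn := hc.sum_abs_le hm hlam0 h1
  rw [hΔ] at h2 h3
  have h4 := integral_excessLoss_minimizer_le hpos hH2 p hlam0.le hc h2 (h3 c hcn)
  rw [generalizationError_sub hbounded (continuous_kernelExpansion K z c).measurable
    (abs_kernelExpansion_le K z hcn)]
  refine h4.trans ?_
  rw [integral_excessLoss_integralTransform hbounded p hg]
  have h5 : ‖T p - g‖ ^ 2 ≤ B * ‖h‖ ^ 2 := by
    have : T p - g = -(ε • p) := by rw [← hpg]; abel
    rw [this, norm_neg, norm_smul, Real.norm_of_nonneg hε0.le, ← hετ, ← mul_pow, mul_assoc]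
    gcongr
  have h6 : lam * (∫ t, |p t| ∂ρ.fst - ∑ j, |c j|) ≤ B * ‖h‖ := by
    have e1 : 0 ≤ ∑ j, |c j| := Finset.sum_nonneg fun j _ => abs_nonneg _
    calc lam * (∫ t, |p t| ∂ρ.fst - ∑ j, |c j|) ≤ lam * (τ * ‖h‖) := by
          refine mul_le_mul_of_nonneg_left ?_ hlam0.le
          linarith [integral_abs_le_norm p]
      _ = B * ‖h‖ := by rw [← hlamτ]; ring
  have h7 : B * ‖h‖ ^ 2 ≤ B * ‖h‖ ^ 2 * L := le_mul_of_one_le_right (by positivity) hL1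
  have h8 : B * ‖h‖ ≤ B * ‖h‖ * L := le_mul_of_one_le_right (by positivity) hL1
  linarith

theorem rate_of_one_le (hM : 0 < M) (hbounded : ∀ᵐ z ∂ρ, |z.2| ≤ M)
    {η Cη : ℝ} (hη : 0 < η) (hCη : 0 < Cη)
    (hcover : ∀ r : ℝ, 0 < r → r ≤ 1 → (coveringNumber X r : ℝ) ≤ Cη / r ^ η)
    (hpos : IsPosDefKernel fun x t => K (x, t)) (hH2 : ConditionH2 fun x t => K (x, t))
    {α Cα : ℝ} (hα : 0 < α) (hCα : 0 < Cα)
    (hlip : ∀ x t t' : X, |K (x, t) - K (x, t')| ≤ Cα * dist t t' ^ α)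
    {s : ℝ} (hs : 1 ≤ s) {g : Lp ℝ 2 ρ.fst}
    (hgs : g ∈ rangeOfPower (integralOperator ρ.fst K) s)
    (hg : g =ᵐ[ρ.fst] regressionFunction ρ) :
    ∃ C : ℝ, 0 < C ∧ ∀ m : ℕ, 1 ≤ m → ∀ lam : ℝ,
      lam = (m : ℝ) ^ (-((1 / 2) * (1 / (1 + η / α)) * ((1 + s) / (1 + 2 * s)))) →
      ∀ δ : ℝ, 0 < δ → δ < 1 →
        HoldsWithConfidence (Measure.pi fun _ : Fin m => ρ) δ fun z =>
          ∀ c : Fin m → ℝ, IsL1Minimizer (fun x t => K (x, t)) z lam c →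
            generalizationError ρ (kernelExpansion (fun x t => K (x, t)) z c)
                - generalizationError ρ (regressionFunction ρ)
              ≤ C * (m : ℝ) ^ (-(1 / (3 * (1 + η / α)))) * Real.log ((1 + m) / δ) := by
  obtain ⟨h, hh⟩ := hgs
  set T := integralOperator ρ.fst K with hT
  have hsym : ∀ f g, inner ℝ (T f) g = inner ℝ f (T g) := integralOperator_symm ρ.fst hpos
  have hnn : ∀ f, 0 ≤ inner ℝ f (T f) := integralOperator_nonneg ρ.fst hpos
  obtain ⟨g₀, hg₀, hg₀h⟩ := exists_preimage_of_one_le hsym hnn hs hh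
  obtain ⟨C, hC, hE⟩ := exists_uniform_event hM hbounded hη hCη hcover hpos hα hCα hlip
    (A₁ := ‖K‖ * ‖g₀‖) (by positivity)
  -- The penalty terms are λε^t and (λ/ε)². This t, admissible since t ≤ min(1, s − 1), and the ε
  -- chosen below make both equal to m^(−θ/3).
  set t := (s - 1) / (s + 2) with ht
  have ht0 : 0 ≤ t := div_nonneg (by linarith) (by linarith)
  have ht1 : t ≤ 1 := by rw [ht, div_le_one (by linarith)]; linarith
  have hts : t ≤ s - 1 := div_le_self (by linarith) (by linarith)
  set W := ‖T‖ ^ (s - 1 - t) * ‖h‖ with hW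
  have hW0 : 0 ≤ W := by positivity
  refine ⟨2 * (4 * W + 4 + 6 * C), by positivity, ?_⟩
  intro m hm lam hlam δ hδ0 hδ1
  have hηα : 0 < η / α := div_pos hη hα
  have hθ3 : 1 / (3 * (1 + η / α)) = 1 / (1 + η / α) / 3 := by field_simp
  rw [hθ3]
  set θ := 1 / (1 + η / α) with hθ
  have hθ0 : 0 < θ := by positivity
  have hm1 : (1 : ℝ) ≤ m := by exact_mod_cast hm
  have hm0 : (0 : ℝ) < m := by linarith
  set L := Real.log ((2 + 2 * m) / δ) with hL
  have hL1 : 1 ≤ L := one_le_log_ratio m hm hδ0 hδ1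
  have hLL : L ≤ 2 * Real.log ((1 + m) / δ) := by
    have e1 : (2 : ℝ) ≤ (1 + m) / δ := by rw [le_div_iff₀ hδ0]; linarith
    have e2 : (2 + 2 * (m : ℝ)) / δ = 2 * ((1 + m) / δ) := by ring
    rw [hL, e2, Real.log_mul (by norm_num) (by positivity)]
    have := Real.log_le_log (by norm_num) e1
    linarith
  set B := (m : ℝ) ^ (-(θ / 3)) with hB
  have hB0 : 0 < B := by positivity
  have hlam0 : 0 < lam := by rw [hlam]; positivity
  have hlam1 : lam ≤ 1 := by
    rw [hlam]
    refine Real.rpow_le_one_of_one_le_of_nonpos hm1 ?_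
    have : 0 < 1 / 2 * θ * ((1 + s) / (1 + 2 * s)) := by positivity
    linarith
  set ε := (m : ℝ) ^ (-(θ * (s + 2) / (6 * (1 + 2 * s)))) with hε
  have hε0 : 0 < ε := by positivity
  have hlamε : (lam * ε⁻¹) ^ 2 = B := by
    rw [hlam, hε, ← Real.rpow_neg hm0.le, ← Real.rpow_add hm0, ← Real.rpow_mul_natCast hm0.le, hB]
    congr 1; push_cast; field_simp; ring
  have hlamt : lam * ε ^ t = B := by
    rw [hlam, hε, ← Real.rpow_mul hm0.le, ← Real.rpow_add hm0, hB, ht]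
    congr 1; field_simp; ring
  -- The left side is m^(−θs/(1+2s))·L, and s/(1+2s) ≥ 1/3 for s ≥ 1.
  have hΔ : (m : ℝ) ^ (-θ) * L / lam ^ 2 ≤ B * L := by
    rw [div_le_iff₀ (by positivity)]
    have e1 : B * L * lam ^ 2 = (B * lam ^ 2) * L := by ring
    rw [e1]
    refine mul_le_mul_of_nonneg_right ?_ (by linarith)
    rw [hlam, ← Real.rpow_mul_natCast hm0.le, hB, ← Real.rpow_add hm0]
    refine Real.rpow_le_rpow_of_exponent_le hm1 ?_
    have e2 : (1 + s) / (1 + 2 * s) ≤ 2 / 3 := by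
      rw [div_le_div_iff₀ (by linarith) (by norm_num)]; linarith
    have e3 := mul_le_mul_of_nonneg_left e2 hθ0.le
    push_cast
    linarith only [e3, hθ0]
  obtain ⟨R, hR, -, -⟩ := exists_resolvent hnn hε0
  set w := R g₀ with hw
  have hwg : T w + ε • w = g₀ := hR g₀
  have hwn : ε * ‖w‖ ≤ W * ε ^ t := by
    have := norm_resolvent_le hsym hnn ht0 ht1 hts hε0 hg₀h hwg
    calc ε * ‖w‖ ≤ ε * (‖T‖ ^ (s - 1 - t) * ε ^ (t - 1) * ‖h‖) := by gcongr
      _ = W * (ε ^ (t - 1) * ε) := by rw [hW]; ring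
      _ = W * ε ^ t := by rw [← Real.rpow_add_one hε0.ne', sub_add_cancel]
  have hf₀ : ∀ x, |integralTransform ρ.fst K g₀ x| ≤ ‖K‖ * ‖g₀‖ / lam := fun x =>
    (abs_integralTransform_le_norm g₀ x).trans (le_div_self (by positivity) hlam0 hlam1)
  obtain ⟨E, hEm, hEP, hEz⟩ := hE m hm lam hlam0 hlam1 δ hδ0 hδ1 _
    (integralTransform ρ.fst K g₀).continuous.measurable hf₀
  refine ⟨E, hEm, hEP, fun z hz c hc => ?_⟩
  obtain ⟨h1, h2, h3⟩ := hEz z hz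
  have hcn := hc.sum_abs_le hm hlam0 h1
  have hCΔ := mul_le_mul_of_nonneg_left hΔ hC.le
  have h4 := integral_excessLoss_minimizer_le hpos hH2 g₀ hlam0.le hc h2 (h3 c hcn)
  rw [generalizationError_sub hbounded (continuous_kernelExpansion K z c).measurable
    (abs_kernelExpansion_le K z hcn)]
  rw [integral_excessLoss_integralTransform hbounded g₀ hg, ← hT, hg₀, sub_self, norm_zero] at h4
  let f : C(X, ℝ) := ⟨_, continuous_kernelExpansion K z c⟩
  have h5 := integral_abs_sub_sum_abs_le hpos hH2 hε0 hwg z c (f := f) fun x => rfl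
  rw [← hT, hg₀] at h5
  have h6 : ∫ w, excessLoss ρ (kernelExpansion (fun x t => K (x, t)) z c) w ∂ρ
      = ‖ContinuousMap.toLp 2 ρ.fst ℝ f - g‖ ^ 2 := by
    rw [integral_excessLoss hbounded (continuous_kernelExpansion K z c).measurable
      (abs_kernelExpansion_le K z hcn)]
    exact integral_sq_sub_eq_norm_sq f hg
  rw [h6] at h4 ⊢
  set N := ‖ContinuousMap.toLp 2 ρ.fst ℝ f - g‖ with hN
  have h7 : 2 * lam * (∫ t, |g₀ t| ∂ρ.fst - ∑ j, |c j|) ≤ 2 * W * B + 2 * (lam * ε⁻¹) * N := by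
    calc 2 * lam * (∫ t, |g₀ t| ∂ρ.fst - ∑ j, |c j|)
        ≤ 2 * lam * (W * ε ^ t + ε⁻¹ * N) := by
          refine mul_le_mul_of_nonneg_left (h5.trans ?_) (by positivity)
          gcongr
      _ = 2 * W * B + 2 * (lam * ε⁻¹) * N := by rw [← hlamt]; ring
  -- Young's inequality: the term linear in the error N is absorbed into the left side N², at the
  -- cost of doubling the constants.
  have h8 : 2 * (lam * ε⁻¹) * N ≤ N ^ 2 / 2 + 2 * B := by
    rw [← hlamε]
    have e1 := sq_nonneg (N - 2 * (lam * ε⁻¹))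
    have e2 : (N - 2 * (lam * ε⁻¹)) ^ 2
        = N ^ 2 - 2 * (2 * (lam * ε⁻¹) * N) + 4 * (lam * ε⁻¹) ^ 2 := by ring
    linarith only [e1, e2]
  have h9 : N ^ 2 ≤ (4 * W + 4) * B + 6 * C * (B * L) := by
    linarith only [h4, h7, h8, hCΔ]
  have h10 : (4 * W + 4) * B ≤ (4 * W + 4) * B * L :=
    le_mul_of_one_le_right (by positivity) hL1
  calc N ^ 2 ≤ (4 * W + 4 + 6 * C) * B * L := by linarith only [h9, h10]
    _ ≤ (4 * W + 4 + 6 * C) * B * (2 * Real.log ((1 + m) / δ)) := by gcongr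
    _ = _ := by ring

end Rates

end

end L1Learning

open L1Learning

theorem mainTheorem2 {X : Type*} [MetricSpace X] [CompactSpace X]
    [MeasurableSpace X] [BorelSpace X]
    (ρ : Measure (X × ℝ)) [IsProbabilityMeasure ρ]
    (M : ℝ) (hM : 0 < M) (hbounded : ∀ᵐ z ∂ρ, |z.2| ≤ M)
    (η Cη : ℝ) (hη : 0 < η) (hCη : 0 < Cη)
    (hcover : ∀ r : ℝ, 0 < r → r ≤ 1 → (coveringNumber X r : ℝ) ≤ Cη / r ^ η)
    (K : C(X × X, ℝ))
    (hpos : IsPosDefKernel fun x t => K (x, t))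
    (hdense : SectionsDense K)
    (hH2 : ConditionH2 fun x t => K (x, t))
    (α Cα : ℝ) (hα : 0 < α) (hCα : 0 < Cα)
    (hlip : ∀ x t t' : X, |K (x, t) - K (x, t')| ≤ Cα * dist t t' ^ α)
    (s : ℝ) (hs : 0 < s)
    (hreg : ∃ g ∈ rangeOfPower (integralOperator ρ.fst K) s, g =ᵐ[ρ.fst] regressionFunction ρ) :
    ∃ C : ℝ, 0 < C ∧ ∀ m : ℕ, 1 ≤ m → ∀ lam : ℝ,
      lam = (m : ℝ) ^ (-((1 / 2) * (1 / (1 + η / α)) * ((1 + s) / (1 + 2 * s)))) →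
      ∀ δ : ℝ, 0 < δ → δ < 1 →
        (s < 1 →
          HoldsWithConfidence (Measure.pi fun _ : Fin m => ρ) δ fun z =>
            ∀ c : Fin m → ℝ, IsL1Minimizer (fun x t => K (x, t)) z lam c →
              generalizationError ρ (kernelExpansion (fun x t => K (x, t)) z c)
                  - generalizationError ρ (regressionFunction ρ)
                ≤ C * (m : ℝ) ^ (-((s / (1 + 2 * s)) * (1 / (1 + η / α))))
                    * Real.log ((2 + 2 * m) / δ)) ∧
        (1 ≤ s →
          HoldsWithConfidence (Measure.pi fun _ : Fin m => ρ) δ fun z =>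
            ∀ c : Fin m → ℝ, IsL1Minimizer (fun x t => K (x, t)) z lam c →
              generalizationError ρ (kernelExpansion (fun x t => K (x, t)) z c)
                  - generalizationError ρ (regressionFunction ρ)
                ≤ C * (m : ℝ) ^ (-(1 / (3 * (1 + η / α))))
                    * Real.log ((1 + m) / δ)) := by
  obtain ⟨g, hgs, hg⟩ := hreg
  rcases lt_or_ge s 1 with hs1 | hs1
  · obtain ⟨C, hC, h⟩ := rate_of_lt_one hM hbounded hη hCη hcover hpos hH2 hα hCα hlip hs hs1
      hgs hg
    exact ⟨C, hC, fun m hm lam hlam δ hδ0 hδ1 =>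
      ⟨fun _ => h m hm lam hlam δ hδ0 hδ1, fun hs' => absurd hs1 (not_lt.2 hs')⟩⟩
  · obtain ⟨C, hC, h⟩ := rate_of_one_le hM hbounded hη hCη hcover hpos hH2 hα hCα hlip hs1
      hgs hg
    exact ⟨C, hC, fun m hm lam hlam δ hδ0 hδ1 =>
      ⟨fun hs' => absurd hs' (not_lt.2 hs1), fun _ => h m hm lam hlam δ hδ0 hδ1⟩⟩
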